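/- Let $d\ge 2$ and let $\mathrm{Poly}_d$ be the space of complex polynomials of degree exactly $d$, identified through coefficients with the open subset $\{b_d\neq 0\}$ of $\mathbb{C}^{d+1}$, so that $T_P\mathrm{Poly}_d=\mathbb{C}^{d+1}$. Let $P\in\mathrm{Poly}_d$ be a hyperbolic, postcritically finite polynomial all of whose critical points (in $\mathbb{C}$) are simple (i.e. $P''\neq0$ there) and periodic. Here $P$ is postcritically finite if the union of the strict forward orbits of its critical points is finite, and hyperbolic if every critical point eventually lands in the basin of attraction of an attracting (or super-attracting) cycle. Let $\mathcal{O}(P)=\{\varphi^{-1}\circ P\circ\varphi : \varphi(z)=\alpha z+\beta,\ \alpha\in\mathbb{C}^*,\ \beta\in\mathbb{C}\}\subset \mathrm{Poly}_d$ be the affine conjugacy orbit of $P$, and $T_P\mathcal{O}(P)$ its tangent space at $P$, i.e. the set of velocities at $P$ of holomorphic curves through $P$ contained in $\mathcal{O}(P)$. Then there exist an open neighbourhood $V\subset\mathrm{Poly}_d$ of $P$ and holomorphic functions $c_0,\dots,c_{d-2}:V\to\mathbb{C}$ such that $\{c_0(Q),\dots,c_{d-2}(Q)\}$ is the set of critical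 points of $Q$ for every $Q\in V$. Moreover, for every such choice of $V$ and $c_0,\dots,c_{d-2}$, and for all integers $m_0,\dots,m_{d-2}\ge 1$ with $P^{m_i}(c_i(P))=c_i(P)$ for each $i$, define $\mathfrak{c},\mathfrak{m}:V\to\mathbb{C}^{d-1}$ by $$\mathfrak{c}(Q)=(c_0(Q),\dots,c_{d-2}(Q)),\qquad \mathfrak{m}(Q)=\bigl(Q^{m_0}(c_0(Q)),\dots,Q^{m_{d-2}}(c_{d-2}(Q))\bigr),$$ where $Q^{m}$ denotes the $m$-th iterate. Then $$\ker(D_P\mathfrak{c}-D_P\mathfrak{m})=T_P\mathcal{O}(P).$$ Furthermore the $d-1$ local hypersurfaces $H_i=\{Q\in V : Q^{m_i}(c_i(Q))=c_i(Q)\}$, $0\le i\le d-2$, are smooth at $P$ and transverse at $P$: near $P$ each $H_i$ is the zero set of a holomorphic function with nonzero differential at $P$, the intersection of the tangent spaces $T_PH_i$ has codimension $d-1$ in $\mathbb{C}^{d+1}$, and the differentials at $P$ of the defining functions $Q\mapsto Q^{m_i}(c_i(Q))-c_i(Q)$ are linearly independent. -/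

import Mathlib

open Polynomial Filter Topology

namespace PolyTrans

noncomputable section

/-- The polynomial `b₀ + b₁ z + ⋯ + b_d z ^ d` with coefficient vector `b`. -/
def toPoly {d : ℕ} (b : Fin (d + 1) → ℂ) : ℂ[X] :=
  ∑ i : Fin (d + 1), C (b i) * X ^ (i : ℕ)

/-- The space of complex polynomials of degree exactly `d`, as the open subset `b_d ≠ 0` of the
space `ℂ^(d+1)` of coefficient vectors. Its tangent space at each point is `ℂ^(d+1)`. -/
def PolyD (d : ℕ) : Set (Fin (d + 1) → ℂ) :=
  {b | b (Fin.last d) ≠ 0}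

/-- The self-map of the complex plane given by the polynomial with coefficient vector `b`. -/
def dyn {d : ℕ} (b : Fin (d + 1) → ℂ) : ℂ → ℂ :=
  fun z => (toPoly b).eval z

/-- The set of critical points in the plane. -/
def critSet {d : ℕ} (b : Fin (d + 1) → ℂ) : Set ℂ :=
  {z | (derivative (toPoly b)).eval z = 0}

/-- The postcritical set: all strict forward iterates of the critical points. -/
def postcritSet {d : ℕ} (b : Fin (d + 1) → ℂ) : Set ℂ :=
  ⋃ n : ℕ, ⋃ _ : 1 ≤ n, (dyn b)^[n] '' critSet b

def IsPostcriticallyFinite {d : ℕ} (b : Fin (d + 1) → ℂ) : Prop :=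
  (postcritSet b).Finite

/-- `p` lies on an attracting (or super-attracting) cycle of `f`, whose period divides `k`. -/
def IsAttractingPeriodicPt (f : ℂ → ℂ) (k : ℕ) (p : ℂ) : Prop :=
  0 < k ∧ Function.IsPeriodicPt f k p ∧ ‖deriv f^[k] p‖ < 1

/-- The basin of attraction of the cycle of a point `p` fixed by `f^[k]`. -/
def basin (f : ℂ → ℂ) (k : ℕ) (p : ℂ) : Set ℂ :=
  {z | ∃ j : ℕ, Tendsto (fun n : ℕ => f^[n * k] z) atTop (𝓝 (f^[j] p))}

/-- Hyperbolicity: each critical point eventually lands in the basin of attraction of an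
attracting (or super-attracting) cycle. -/
def IsHyperbolic {d : ℕ} (b : Fin (d + 1) → ℂ) : Prop :=
  ∀ c ∈ critSet b, ∃ (k : ℕ) (p : ℂ), IsAttractingPeriodicPt (dyn b) k p ∧
    ∃ n : ℕ, (dyn b)^[n] c ∈ basin (dyn b) k p

/-- All critical points are simple: the second derivative does not vanish there. -/
def HasSimpleCritPts {d : ℕ} (b : Fin (d + 1) → ℂ) : Prop :=
  ∀ c ∈ critSet b, (derivative (derivative (toPoly b))).eval c ≠ 0

/-- All critical points are periodic. -/
def HasPeriodicCritPts {d : ℕ} (b : Fin (d + 1) → ℂ) : Prop :=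
  ∀ c ∈ critSet b, c ∈ Function.periodicPts (dyn b)

/-- The orbit of `P` under conjugacy by affine maps `φ z = α z + β` with `α ≠ 0`:
all `Q` of degree `d` with `φ ∘ Q = P ∘ φ`, that is, `Q = φ⁻¹ ∘ P ∘ φ`. -/
def affineOrbit {d : ℕ} (P : Fin (d + 1) → ℂ) : Set (Fin (d + 1) → ℂ) :=
  {Q | Q ∈ PolyD d ∧ ∃ α β : ℂ, α ≠ 0 ∧ ∀ z : ℂ, α * dyn Q z + β = dyn P (α * z + β)}

/-- `c i`, for `i = 0, …, d - 2`, are holomorphic functions on an open neighbourhood `V` of `P`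
in the space of polynomials of degree `d`, and they mark all critical points. -/
structure IsCritMarking {d : ℕ} (P : Fin (d + 1) → ℂ) (V : Set (Fin (d + 1) → ℂ))
    (c : Fin (d - 1) → (Fin (d + 1) → ℂ) → ℂ) : Prop where
  isOpen : IsOpen V
  mem : P ∈ V
  subset : V ⊆ PolyD d
  holo : ∀ i, DifferentiableOn ℂ (c i) V
  range_eq : ∀ Q ∈ V, Set.range (fun i => c i Q) = critSet Q

/-- The map `Q ↦ (c₀(Q), …, c_{d-2}(Q))`. -/
def critMap {d : ℕ} (c : Fin (d - 1) → (Fin (d + 1) → ℂ) → ℂ) :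
    (Fin (d + 1) → ℂ) → (Fin (d - 1) → ℂ) :=
  fun Q i => c i Q

/-- The map `Q ↦ (Q^{m₀}(c₀(Q)), …, Q^{m_{d-2}}(c_{d-2}(Q)))`. -/
def iterMap {d : ℕ} (c : Fin (d - 1) → (Fin (d + 1) → ℂ) → ℂ) (m : Fin (d - 1) → ℕ) :
    (Fin (d + 1) → ℂ) → (Fin (d - 1) → ℂ) :=
  fun Q i => (dyn Q)^[m i] (c i Q)

/-- The local hypersurface `{Q ∈ V : Q^{m_i}(c_i(Q)) = c_i(Q)}`. -/
def perHypersurface {d : ℕ} (V : Set (Fin (d + 1) → ℂ))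
    (c : Fin (d - 1) → (Fin (d + 1) → ℂ) → ℂ) (m : Fin (d - 1) → ℕ) (i : Fin (d - 1)) :
    Set (Fin (d + 1) → ℂ) :=
  {Q | Q ∈ V ∧ (dyn Q)^[m i] (c i Q) = c i Q}

section Geometry

variable {E : Type*} [NormedAddCommGroup E] [NormedSpace ℂ E]

/-- The velocities at time `0` of the germs of holomorphic curves through `x` contained in `S`.
If `S` is a complex submanifold, this is its tangent space at `x`. -/
def tangentVectors (S : Set E) (x : E) : Set E :=
  {v | ∃ γ : ℂ → E, ∃ r > 0, DifferentiableOn ℂ γ (Metric.ball 0 r) ∧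
    (∀ t ∈ Metric.ball (0 : ℂ) r, γ t ∈ S) ∧ γ 0 = x ∧ deriv γ 0 = v}

/-- Near its point `x`, the set `S` is a smooth complex hypersurface: it is the zero set of a
holomorphic function whose differential at `x` is not zero. -/
def IsSmoothHypersurfaceAt (S : Set E) (x : E) : Prop :=
  x ∈ S ∧ ∃ (U : Set E) (g : E → ℂ), IsOpen U ∧ x ∈ U ∧ DifferentiableOn ℂ g U ∧
    fderiv ℂ g x ≠ 0 ∧ S ∩ U = {y | y ∈ U ∧ g y = 0}

/-- A finite family of hypersurfaces is transverse at `x`: the tangent spaces at `x` are linear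
subspaces whose intersection has codimension the number of hypersurfaces. -/
def IsTransverseAt {ι : Type*} [Fintype ι] (S : ι → Set E) (x : E) : Prop :=
  ∃ T : ι → Submodule ℂ E, (∀ i, (T i : Set E) = tangentVectors (S i) x) ∧
    Module.finrank ℂ (⨅ i, T i : Submodule ℂ E) + Fintype.card ι = Module.finrank ℂ E

end Geometry

end

end PolyTrans

/-!
A linear relation between the differentials of the functions `Q ↦ Q^{m_i}(c_i(Q)) - c_i(Q)` at `P`,
tested against the velocities of degree at most `d - 2`, makes a combination `q` of rational
functions with simple poles along the critical cycles satisfy `P_*(q dz²) = q dz²`: the test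
polynomials are `(P'(z) - P'(u)) / (z - u)` at the preimages `u` of a point `y`, and the partial
fraction decomposition of `1 / (P(z) - y)` adds up the results. Push-forward does not increase the
area `∫ |q|`, and a large disk `B` contains `P⁻¹(B)` with an annulus to spare. The annulus must
therefore carry no mass, so that `q` vanishes identically. The residue of `q` at `c_i(P)` is, up to
sign, the `i`-th coefficient of the relation: the differentials are linearly independent, and their
kernels meet in a plane. The velocities `P' ξ - ξ ∘ P`, with `ξ` affine, of the conjugates of `P`
lie in these kernels and form a plane too, whence the equality with the tangent space of the orbit.
-/

namespace PolyTrans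

open MeasureTheory
open scoped ENNReal ContDiff

/-! ### Push-forward of quadratic differentials -/

theorem exists_measurable_partition_injOn {X Y : Type*} [TopologicalSpace X]
    [SecondCountableTopology X] [MeasurableSpace X] [OpensMeasurableSpace X] {f : X → Y}
    {s : Set X} (hs : MeasurableSet s) (hf : ∀ x ∈ s, ∃ U ∈ 𝓝 x, Set.InjOn f U) :
    ∃ A : ℕ → Set X, (∀ n, MeasurableSet (A n)) ∧ Pairwise (Function.onFun Disjoint A) ∧
      (∀ n, Set.InjOn f (A n)) ∧ ⋃ n, A n = s := by
  have hopen : ∀ x, ∃ U, x ∈ s → IsOpen U ∧ x ∈ U ∧ Set.InjOn f U := fun x => by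
    by_cases hx : x ∈ s
    · obtain ⟨W, hW, hinj⟩ := hf x hx
      obtain ⟨U, hUW, hU, hxU⟩ := mem_nhds_iff.1 hW
      exact ⟨U, fun _ => ⟨hU, hxU, hinj.mono hUW⟩⟩
    · exact ⟨∅, fun h => (hx h).elim⟩
  choose U hU using hopen
  obtain ⟨t, hts, ht, hcover⟩ := TopologicalSpace.countable_cover_nhdsWithin (f := U) (s := s)
    fun x hx => mem_nhdsWithin_of_mem_nhds ((hU x hx).1.mem_nhds (hU x hx).2.1)
  rcases t.eq_empty_or_nonempty with rfl | hne
  · refine ⟨fun _ => ∅, fun _ => .empty, fun _ _ _ => disjoint_bot_left,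
      fun _ => Set.injOn_empty f, ?_⟩
    simpa [eq_comm, Set.subset_empty_iff] using hcover
  obtain ⟨e, rfl⟩ := ht.exists_eq_range hne
  have he : ∀ n, e n ∈ s := fun n => hts ⟨n, rfl⟩
  refine ⟨fun n => s ∩ disjointed (U ∘ e) n, fun n => hs.inter ?_, fun i j hij => ?_,
    fun n => ?_, ?_⟩
  · exact .disjointed (fun n => (hU _ (he n)).1.measurableSet) n
  · exact (disjoint_disjointed _ hij).mono Set.inter_subset_right Set.inter_subset_right
  · exact (hU _ (he n)).2.2.mono (Set.inter_subset_right.trans (disjointed_le _ n))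
  · rw [← Set.inter_iUnion, iUnion_disjointed, Set.inter_eq_left]
    simpa using hcover

section AreaInequality

variable {E : Type*} [NormedAddCommGroup E] [NormedSpace ℝ E] [FiniteDimensional ℝ E]
  [MeasurableSpace E] [BorelSpace E] (μ : Measure E) [μ.IsAddHaarMeasure]
  {f : E → E} {f' : E → E →L[ℝ] E} {s : Set E}

theorem lintegral_extend_domRestrict_eq_lintegral_abs_det_fderiv_mul (hs : MeasurableSet s)
    (hf' : ∀ x ∈ s, HasFDerivWithinAt f (f' x) s x) (hf : Set.InjOn f s) (h : E → ℝ≥0∞) :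
    ∫⁻ y, Function.extend (s.domRestrict f) (fun x => h x) 0 y ∂μ =
      ∫⁻ x in s, ENNReal.ofReal |(f' x).det| * h x ∂μ := by
  rw [← setLIntegral_eq_of_support_subset (s := f '' s),
    lintegral_image_eq_lintegral_abs_det_fderiv_mul μ hs hf' hf]
  · refine setLIntegral_congr_fun hs fun x hx => ?_
    exact congrArg _ (hf.injective.extend_apply (fun x : s => h x) 0 ⟨x, hx⟩)
  · refine Function.support_subset_iff'.2 fun y hy => Function.extend_apply' _ _ _ ?_
    rintro ⟨⟨x, hx⟩, rfl⟩
    exact hy ⟨x, hx, rfl⟩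

theorem lintegral_le_lintegral_abs_det_fderiv_mul (hs : MeasurableSet s)
    (hf' : ∀ x ∈ s, HasFDerivWithinAt f (f' x) s x) (hf : ∀ x ∈ s, ∃ U ∈ 𝓝 x, Set.InjOn f U)
    {g h : E → ℝ≥0∞} (hh : Measurable h)
    (hg : ∀ᵐ y ∂μ, g y ≤ ∑' u : ↥(s ∩ f ⁻¹' {y}), h u) :
    ∫⁻ y, g y ∂μ ≤ ∫⁻ x in s, ENNReal.ofReal |(f' x).det| * h x ∂μ := by
  obtain ⟨A, hAm, hAd, hAi, hAs⟩ := exists_measurable_partition_injOn hs hf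
  have hAf' : ∀ n, ∀ x ∈ A n, HasFDerivWithinAt f (f' x) (A n) x := fun n x hx =>
    have hsub : A n ⊆ s := hAs ▸ Set.subset_iUnion A n
    (hf' x (hsub hx)).mono hsub
  let F : ℕ → E → ℝ≥0∞ := fun n => Function.extend ((A n).domRestrict f) (fun x => h x) 0
  have hFm : ∀ n, Measurable (F n) := fun n =>
    (measurableEmbedding_of_fderivWithin (hAm n) (hAf' n) (hAi n)).measurable_extend
      (hh.comp measurable_subtype_coe) measurable_const
  have fiber_le : ∀ y, ∑' u : ↥(s ∩ f ⁻¹' {y}), h u ≤ ∑' n, F n y := by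
    intro y
    have hpiece : ∀ u : ↥(s ∩ f ⁻¹' {y}), ∃ n, (u : E) ∈ A n := fun u =>
      Set.mem_iUnion.1 (hAs ▸ u.2.1)
    choose N hN using hpiece
    have hFN : ∀ u : ↥(s ∩ f ⁻¹' {y}), h u = F (N u) y := fun u =>
      ((hAi _).injective.extend_apply (fun x : A (N u) => h x) 0 ⟨u, hN u⟩).symm.trans
        (congrArg (F (N u)) u.2.2)
    have hNinj : Function.Injective N := fun u v huv =>
      Subtype.ext (hAi (N v) (huv ▸ hN u) (hN v) (u.2.2.trans v.2.2.symm))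
    simp only [hFN]
    exact ENNReal.tsum_comp_le_tsum_of_injective hNinj fun n => F n y
  calc ∫⁻ y, g y ∂μ ≤ ∫⁻ y, ∑' n, F n y ∂μ :=
        lintegral_mono_ae (hg.mono fun y hy => hy.trans (fiber_le y))
    _ = ∑' n, ∫⁻ x in A n, ENNReal.ofReal |(f' x).det| * h x ∂μ := by
        rw [lintegral_tsum fun n => (hFm n).aemeasurable]
        simp only [F, lintegral_extend_domRestrict_eq_lintegral_abs_det_fderiv_mul μ (hAm _)
          (hAf' _) (hAi _)]
    _ = ∫⁻ x in s, ENNReal.ofReal |(f' x).det| * h x ∂μ := by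
        rw [← lintegral_iUnion hAm hAd, hAs]

end AreaInequality

theorem det_restrictScalars_toSpanSingleton (a : ℂ) :
    ((ContinuousLinearMap.toSpanSingleton ℂ a).restrictScalars ℝ : ℂ →L[ℝ] ℂ).det = ‖a‖ ^ 2 := by
  simp [ContinuousLinearMap.det, LinearMap.det_restrictScalars, Algebra.norm_complex_eq,
    Complex.normSq_eq_norm_sq]

/-- The push-forward `p_* (q dz²)` of a quadratic differential by a polynomial, as a coefficient
function. A critical point `u` contributes `q u / 0 = 0`, so the value is meaningful only where `y`
is not a critical value. -/
noncomputable def quadPushforward (p : ℂ[X]) (q : ℂ → ℂ) (y : ℂ) : ℂ :=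
  ∑ u ∈ (p - C y).roots.toFinset, q u / (derivative p).eval u ^ 2

theorem exists_nhds_injOn_eval {p : ℂ[X]} {z : ℂ} (hz : (derivative p).eval z ≠ 0) :
    ∃ U ∈ 𝓝 z, Set.InjOn (fun w => p.eval w) U := by
  have h := (p.hasStrictDerivAt z).hasStrictFDerivAt_equiv hz
  refine ⟨(h.toOpenPartialHomeomorph _).source, ?_, (h.toOpenPartialHomeomorph _).injOn⟩
  exact (h.toOpenPartialHomeomorph _).open_source.mem_nhds
    h.mem_toOpenPartialHomeomorph_source

theorem enorm_quadPushforward_le (p : ℂ[X]) (q : ℂ → ℂ) (y : ℂ) :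
    ‖quadPushforward p q y‖ₑ ≤
      ∑' u : ↥({u | (derivative p).eval u ≠ 0} ∩ (fun z => p.eval z) ⁻¹' {y}),
        ‖q u / (derivative p).eval (u : ℂ) ^ 2‖ₑ := by
  set s : Finset ℂ := {u ∈ (p - C y).roots.toFinset | (derivative p).eval u ≠ 0}
  have hsum : quadPushforward p q y = ∑ u ∈ s, q u / (derivative p).eval u ^ 2 := by
    refine (Finset.sum_filter_of_ne fun u _ hu => ?_).symm
    contrapose! hu
    simp [hu]
  have hsub : (s : Set ℂ) ⊆ {u | (derivative p).eval u ≠ 0} ∩ (fun z => p.eval z) ⁻¹' {y} := by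
    intro u hu
    obtain ⟨hroot, hu'⟩ := Finset.mem_filter.1 (Finset.mem_coe.1 hu)
    refine ⟨hu', ?_⟩
    simpa [sub_eq_zero] using (mem_roots'.1 (Multiset.mem_toFinset.1 hroot)).2
  calc ‖quadPushforward p q y‖ₑ ≤ ∑ u ∈ s, ‖q u / (derivative p).eval u ^ 2‖ₑ :=
        hsum ▸ enorm_sum_le _ _
    _ = ∑' u : ↥(s : Set ℂ), ‖q u / (derivative p).eval (u : ℂ) ^ 2‖ₑ :=
        (Finset.tsum_subtype' s fun u => ‖q u / (derivative p).eval u ^ 2‖ₑ).symm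
    _ ≤ _ := ENNReal.tsum_mono_subtype (fun u => ‖q u / (derivative p).eval u ^ 2‖ₑ) hsub

theorem lintegral_enorm_quadPushforward_le (p : ℂ[X]) {q : ℂ → ℂ} (hq : Measurable q) {B : Set ℂ}
    (hB : MeasurableSet B) :
    ∫⁻ y in B, ‖quadPushforward p q y‖ₑ ≤ ∫⁻ z in (fun z => p.eval z) ⁻¹' B, ‖q z‖ₑ := by
  set s : Set ℂ := {u | (derivative p).eval u ≠ 0} ∩ (fun z => p.eval z) ⁻¹' B
  have hs : MeasurableSet s :=
    (isOpen_ne.preimage (derivative p).continuous).measurableSet.inter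
      (p.continuous.measurable hB)
  have hp' : ∀ z ∈ s, HasFDerivWithinAt (fun z => p.eval z)
      ((ContinuousLinearMap.toSpanSingleton ℂ ((derivative p).eval z)).restrictScalars ℝ) s z :=
    fun z _ => ((p.hasDerivAt z).hasFDerivAt.restrictScalars ℝ).hasFDerivWithinAt
  have hw : Measurable fun z => ‖q z / (derivative p).eval z ^ 2‖ₑ :=
    (hq.div ((derivative p).continuous.measurable.pow_const 2)).enorm
  rw [← lintegral_indicator hB]
  calc ∫⁻ y, B.indicator (fun y => ‖quadPushforward p q y‖ₑ) y
      ≤ ∫⁻ z in s, ENNReal.ofReal |((ContinuousLinearMap.toSpanSingleton ℂ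
          ((derivative p).eval z)).restrictScalars ℝ : ℂ →L[ℝ] ℂ).det| *
          ‖q z / (derivative p).eval z ^ 2‖ₑ := by
        refine lintegral_le_lintegral_abs_det_fderiv_mul volume hs hp'
          (fun z hz => exists_nhds_injOn_eval hz.1) hw (Eventually.of_forall fun y => ?_)
        by_cases hy : y ∉ B
        · simp [hy]
        rw [Set.indicator_of_mem (not_not.1 hy)]
        refine (enorm_quadPushforward_le p q y).trans
          (ENNReal.tsum_mono_subtype (fun u => ‖q u / (derivative p).eval u ^ 2‖ₑ) ?_)
        rintro u ⟨hu, rfl⟩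
        exact ⟨⟨hu, not_not.1 hy⟩, rfl⟩
    _ = ∫⁻ z in s, ‖q z‖ₑ := by
        refine setLIntegral_congr_fun hs fun z hz => ?_
        simp only [det_restrictScalars_toSpanSingleton]
        rw [abs_of_nonneg (by positivity), ← norm_pow, ofReal_norm, ← enorm_mul,
          mul_div_cancel₀ _ (pow_ne_zero 2 hz.1)]
    _ ≤ ∫⁻ z in (fun z => p.eval z) ⁻¹' B, ‖q z‖ₑ := lintegral_mono_set Set.inter_subset_right

theorem ae_eq_zero_restrict_sdiff_preimage {p : ℂ[X]} {q : ℂ → ℂ} (hq : Measurable q)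
    (hpush : q =ᵐ[volume] quadPushforward p q) {B : Set ℂ} (hB : MeasurableSet B)
    (hint : IntegrableOn q B) (hsub : (fun z => p.eval z) ⁻¹' B ⊆ B) :
    q =ᵐ[volume.restrict (B \ (fun z => p.eval z) ⁻¹' B)] 0 := by
  set B' : Set ℂ := (fun z => p.eval z) ⁻¹' B
  have hB' : MeasurableSet B' := p.continuous.measurable hB
  have hfin : ∫⁻ z in B', ‖q z‖ₑ ≠ ⊤ := ((lintegral_mono_set hsub).trans_lt hint.2).ne
  have hmass : (∫⁻ z in B', ‖q z‖ₑ) + ∫⁻ z in B \ B', ‖q z‖ₑ ≤ (∫⁻ z in B', ‖q z‖ₑ) + 0 :=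
    calc (∫⁻ z in B', ‖q z‖ₑ) + ∫⁻ z in B \ B', ‖q z‖ₑ = ∫⁻ z in B, ‖q z‖ₑ := by
          rw [← lintegral_inter_add_sdiff (fun z => ‖q z‖ₑ) B hB',
            Set.inter_eq_self_of_subset_right hsub]
      _ = ∫⁻ z in B, ‖quadPushforward p q z‖ₑ :=
          lintegral_congr_ae ((ae_restrict_of_ae hpush).mono fun z hz => congrArg _ hz)
      _ ≤ (∫⁻ z in B', ‖q z‖ₑ) + 0 := by
          rw [add_zero]; exact lintegral_enorm_quadPushforward_le p hq hB
  have hzero : ∫⁻ z in B \ B', ‖q z‖ₑ = 0 :=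
    nonpos_iff_eq_zero.1 ((ENNReal.add_le_add_iff_left hfin).1 hmass)
  exact ((lintegral_eq_zero_iff hq.enorm).1 hzero).mono fun z hz => by simpa using hz

theorem exists_forall_lt_norm_eval {𝕜 : Type*} [NormedField 𝕜] {p : 𝕜[X]}
    (hp : 2 ≤ p.natDegree) : ∃ R : ℝ, 0 < R ∧ ∀ z : 𝕜, R ≤ ‖z‖ → R < ‖p.eval z‖ := by
  have hdiv : 0 < p.divX.degree := by
    rw [← natDegree_pos_iff_degree_pos, natDegree_divX_eq_natDegree_tsub_one]
    omega
  have hlarge := p.divX.tendsto_norm_atTop hdiv tendsto_norm_cobounded_atTop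
  obtain ⟨r, hr⟩ : ∃ r : ℝ, ∀ z : 𝕜, r ≤ ‖z‖ → 2 < ‖p.divX.eval z‖ := by
    have := hlarge.eventually_gt_atTop 2
    rw [← comap_norm_atTop, eventually_comap] at this
    obtain ⟨r, hr⟩ := eventually_atTop.1 this
    exact ⟨r, fun z hz => hr _ hz z rfl⟩
  refine ⟨max r (‖p.coeff 0‖ + 1), by positivity, fun z hz => ?_⟩
  have hbig := hr z ((le_max_left _ _).trans hz)
  have hz' := (le_max_right _ _).trans hz
  have heval : z * p.divX.eval z = p.eval z - p.coeff 0 := by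
    rw [eq_sub_iff_add_eq]
    simpa only [eval_add, eval_mul, eval_X, eval_C] using congrArg (eval z) (X_mul_divX_add p)
  have hle : ‖z‖ * ‖p.divX.eval z‖ ≤ ‖p.eval z‖ + ‖p.coeff 0‖ := by
    rw [← norm_mul, heval]
    exact norm_sub_le _ _
  nlinarith [norm_nonneg z, norm_nonneg (p.coeff 0)]

theorem eqOn_zero_of_ae_eq_quadPushforward {p : ℂ[X]} (hp : 2 ≤ p.natDegree) {q : ℂ → ℂ}
    (hq : Measurable q) (hint : LocallyIntegrable q) (hpush : q =ᵐ[volume] quadPushforward p q)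
    {F : Set ℂ} (hF : F.Countable) (hFc : IsClosed F) (hqF : DifferentiableOn ℂ q Fᶜ) :
    Set.EqOn q 0 Fᶜ := by
  obtain ⟨R, hR0, hR⟩ := exists_forall_lt_norm_eval hp
  set B : Set ℂ := Metric.ball 0 R with hBdef
  have hsub : (fun z => p.eval z) ⁻¹' B ⊆ B := fun z hz => by
    simp only [hBdef, Set.mem_preimage, mem_ball_zero_iff] at hz ⊢
    exact not_le.1 fun hcon => (hR z hcon).not_gt hz
  have hannulus := ae_eq_zero_restrict_sdiff_preimage hq hpush Metric.isOpen_ball.measurableSet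
    ((hint.integrableOn_isCompact (isCompact_closedBall 0 R)).mono_set
      Metric.ball_subset_closedBall) hsub
  have hescape : IsOpen {z : ℂ | R < ‖p.eval z‖} := isOpen_lt continuous_const p.continuous.norm
  have hO : IsOpen (B ∩ {z | R < ‖p.eval z‖}) := Metric.isOpen_ball.inter hescape
  have hne : (B ∩ {z | R < ‖p.eval z‖}).Nonempty := by
    have hmem : (R : ℂ) ∈ closure B := by simp [hBdef, closure_ball _ hR0.ne', abs_of_pos hR0]
    rw [Set.inter_comm]
    exact mem_closure_iff.1 hmem _ hescape (hR _ (by simp [abs_of_pos hR0]))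
  have hzero : Set.EqOn q 0 (B ∩ {z | R < ‖p.eval z‖} ∩ Fᶜ) := by
    refine Measure.eqOn_open_of_ae_eq (μ := volume)
      (ae_restrict_of_ae_restrict_of_subset ?_ hannulus) (hO.inter hFc.isOpen_compl)
      (hqF.continuousOn.mono Set.inter_subset_right) continuousOn_const
    rintro z ⟨⟨hzB, hz⟩, -⟩
    refine ⟨hzB, fun hz' => ?_⟩
    exact lt_asymm (show R < ‖p.eval z‖ from hz) (mem_ball_zero_iff.1 hz')
  obtain ⟨z, hzO, hzF⟩ := (hF.dense_compl ℂ).inter_open_nonempty _ hO hne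
  exact (hqF.analyticOnNhd hFc.isOpen_compl).eqOn_zero_of_preconnected_of_eventuallyEq_zero
    (hF.isConnected_compl_of_one_lt_rank (by simp)).isPreconnected hzF
    (hzero.eventuallyEq_of_mem ((hO.inter hFc.isOpen_compl).mem_nhds ⟨hzO, hzF⟩))

/-- The Cauchy transform `y ↦ ∑ k, a k / (x k - y)` of the finite measure with masses `a k` at the
points `x k`: the general form of a rational function with simple poles vanishing at infinity. The
division convention drops the term `k` at `y = x k`. -/
noncomputable def cauchyTransform {κ : Type*} [Fintype κ] (a x : κ → ℂ) (y : ℂ) : ℂ :=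
  ∑ k, a k / (x k - y)

section CauchyTransform

variable {κ : Type*} [Fintype κ] (a x : κ → ℂ)

theorem measurable_cauchyTransform : Measurable (cauchyTransform a x) :=
  Finset.measurable_sum _ fun _ _ => measurable_const.div (measurable_const.sub measurable_id)

theorem locallyIntegrable_inv : LocallyIntegrable fun z : ℂ => z⁻¹ :=
  locallyIntegrable_of_norm_le_rpow (C := 1) (α := 1) (by simp) (by simp)
    (Eventually.of_forall fun z => by simp [Real.rpow_neg_one])
    measurable_inv.aestronglyMeasurable

theorem locallyIntegrable_cauchyTransform : LocallyIntegrable (cauchyTransform a x) := by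
  have hterm : ∀ c : ℂ, LocallyIntegrable fun y : ℂ => (c - y)⁻¹ := fun c =>
    (locallyIntegrable_map_homeomorph (Homeomorph.subLeft c) (f := fun z : ℂ => z⁻¹)).1 <|
      (Measure.map_sub_left_eq_self volume c).symm ▸ locallyIntegrable_inv
  refine locallyIntegrable_finsetSum _ fun k _ => ?_
  simp only [div_eq_mul_inv]
  exact (hterm (x k)).smul (a k)

theorem differentiableOn_cauchyTransform :
    DifferentiableOn ℂ (cauchyTransform a x) (Set.range x)ᶜ :=
  .fun_sum fun k _ => (differentiableOn_const _).div (differentiableOn_id.const_sub _)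
    fun _ hy h0 => hy ⟨k, sub_eq_zero.1 h0⟩

theorem tendsto_sub_mul_cauchyTransform (y : ℂ) :
    Tendsto (fun z => (y - z) * cauchyTransform a x z) (𝓝[≠] y) (𝓝 (∑ k with x k = y, a k)) := by
  simp only [cauchyTransform, Finset.mul_sum, Finset.sum_filter]
  refine tendsto_finsetSum _ fun k _ => ?_
  split_ifs with h
  · subst h
    refine tendsto_const_nhds.congr' ?_
    filter_upwards [self_mem_nhdsWithin] with z hz
    rw [mul_div_cancel₀ _ (sub_ne_zero.2 (Ne.symm hz))]
  · have : ContinuousAt (fun z => (y - z) * (a k / (x k - z))) y :=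
      (continuousAt_const.sub continuousAt_id).mul
        (continuousAt_const.div (continuousAt_const.sub continuousAt_id) (sub_ne_zero.2 h))
    simpa using this.tendsto.mono_left nhdsWithin_le_nhds

end CauchyTransform

/-! ### The variation of a periodic critical point -/

theorem nodup_roots_of_eval_derivative_ne_zero {R : Type*} [CommRing R] [IsDomain R] {r : R[X]}
    (h : ∀ u, r.eval u = 0 → (derivative r).eval u ≠ 0) : r.roots.Nodup := by
  classical
  rcases eq_or_ne r 0 with rfl | hr
  · simp
  refine Multiset.nodup_iff_count_le_one.2 fun u => ?_
  rw [count_roots]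
  by_contra! hmult
  obtain ⟨hroot, hroot'⟩ := (one_lt_rootMultiplicity_iff_isRoot hr).1 hmult
  exact h u hroot hroot'

theorem inv_eval_eq_sum_roots {K : Type*} [Field K] [DecidableEq K] {r : K[X]} (hsplit : r.Splits)
    (hdeg : 0 < r.natDegree) (hnodup : r.roots.Nodup) {z : K} (hz : r.eval z ≠ 0) :
    (r.eval z)⁻¹ = ∑ u ∈ r.roots.toFinset, ((derivative r).eval u)⁻¹ * (z - u)⁻¹ := by
  set s := r.roots.toFinset with hs
  obtain ⟨a, ha, hfactor⟩ : ∃ a, a ≠ 0 ∧ r = C a * Lagrange.nodal s id := by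
    refine ⟨r.leadingCoeff, leadingCoeff_ne_zero.2 (ne_zero_of_natDegree_gt hdeg), ?_⟩
    conv_lhs => rw [hsplit.eq_prod_roots]
    rw [Lagrange.nodal, Finset.prod, hs, Multiset.toFinset_val, hnodup.dedup]
    rfl
  have hne : s.Nonempty := by
    rw [hs, Multiset.toFinset_nonempty, ← Multiset.card_pos, ← hsplit.natDegree_eq_card_roots]
    exact hdeg
  have hzs : ∀ u ∈ s, z ≠ id u := by
    rintro u hu rfl
    exact hz (mem_roots'.1 (Multiset.mem_toFinset.1 hu)).2
  have hlagrange := Lagrange.eval_interpolate_not_at_node (1 : K → K) hzs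
  rw [Lagrange.interpolate_one Function.injective_id.injOn hne, eval_one] at hlagrange
  have hweight : ∀ u ∈ s, Lagrange.nodalWeight s id u = a * ((derivative r).eval u)⁻¹ :=
    fun u hu => by
      rw [Lagrange.nodalWeight_eq_eval_derivative_nodal hu, hfactor, derivative_C_mul, eval_C_mul,
        mul_inv, mul_inv_cancel_left₀ ha, id]
  have heval : r.eval z = a * (Lagrange.nodal s id).eval z := by rw [hfactor, eval_C_mul]
  refine inv_eq_of_mul_eq_one_right ?_
  rw [hlagrange, heval, mul_comm a, mul_assoc, Finset.mul_sum]
  refine congrArg _ (Finset.sum_congr rfl fun u hu => ?_)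
  rw [hweight u hu, Pi.one_apply, mul_one, mul_assoc, id]

/-- The derivative of the iterate `p^[m - k]` at the point `p^[k] c` of the orbit of `c`, written
as a product by the chain rule. -/
noncomputable def orbitWeight {R : Type*} [CommSemiring R] (p : R[X]) (c : R) (m k : ℕ) : R :=
  ∏ j ∈ Finset.Ico k m, (derivative p).eval ((p.eval ·)^[j] c)

section OrbitWeight

variable {R : Type*} [CommSemiring R] (p : R[X]) (c : R)

theorem orbitWeight_self (m : ℕ) : orbitWeight p c m m = 1 := by
  simp [orbitWeight]

theorem orbitWeight_eq_mul {m k : ℕ} (hk : k < m) : orbitWeight p c m k =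
    (derivative p).eval ((p.eval ·)^[k] c) * orbitWeight p c m (k + 1) :=
  Finset.prod_eq_prod_Ico_succ_bot hk _

theorem orbitWeight_succ {m k : ℕ} (hk : k ≤ m) : orbitWeight p c (m + 1) k =
    (derivative p).eval ((p.eval ·)^[m] c) * orbitWeight p c m k := by
  rw [orbitWeight, Finset.prod_Ico_succ_top hk, mul_comm, orbitWeight]

end OrbitWeight

/-- `c` is a simple critical point of `p` lying on a cycle whose period divides `m ≥ 1`. -/
structure IsSimplePeriodicCritPt {R : Type*} [CommSemiring R] (p : R[X]) (c : R) (m : ℕ) :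
    Prop where
  crit : (derivative p).eval c = 0
  simple : (derivative (derivative p)).eval c ≠ 0
  pos : 1 ≤ m
  periodic : Function.IsPeriodicPt (p.eval ·) m c

/-- The derivative of `p^[m] c - c` when `p` moves with velocity `f` and `c` is followed as a simple
critical point, lying on a cycle whose period divides `m ≥ 1`: the point `c` then moves with
velocity `- f' c / p'' c`. -/
noncomputable def critVariation {𝕜 : Type*} [NontriviallyNormedField 𝕜] (p : 𝕜[X]) (c : 𝕜) (m : ℕ)
    (f : 𝕜 → 𝕜) : 𝕜 :=
  deriv f c / (derivative (derivative p)).eval c +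
    ∑ k ∈ Finset.range m, orbitWeight p c m (k + 1) * f ((p.eval ·)^[k] c)

theorem differentiableAt_inv_sub {𝕜 : Type*} [NontriviallyNormedField 𝕜] {z u : 𝕜} (h : z ≠ u) :
    DifferentiableAt 𝕜 (fun w => (w - u)⁻¹) z :=
  (differentiableAt_id.sub_const u).fun_inv (sub_ne_zero.2 h)

section CritVariation

variable {𝕜 : Type*} [NontriviallyNormedField 𝕜] {p : 𝕜[X]} {c : 𝕜} {m : ℕ} {f g : 𝕜 → 𝕜}

theorem critVariation_congr (hc : f =ᶠ[𝓝 c] g)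
    (h : ∀ k < m, f ((p.eval ·)^[k] c) = g ((p.eval ·)^[k] c)) :
    critVariation p c m f = critVariation p c m g := by
  rw [critVariation, hc.deriv_eq,
    Finset.sum_congr rfl fun k hk => by rw [h k (Finset.mem_range.1 hk)], ← critVariation]

theorem critVariation_sub (hf : DifferentiableAt 𝕜 f c) (hg : DifferentiableAt 𝕜 g c) :
    critVariation p c m (fun z => f z - g z) = critVariation p c m f - critVariation p c m g := by
  simp only [critVariation, deriv_fun_sub hf hg, mul_sub, Finset.sum_sub_distrib, sub_div]
  ring

theorem critVariation_const_mul (a : 𝕜) (f : 𝕜 → 𝕜) :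
    critVariation p c m (fun z => a * f z) = a * critVariation p c m f := by
  simp only [critVariation, deriv_const_mul_field, mul_add, Finset.mul_sum, mul_div_assoc]
  exact congrArg _ (Finset.sum_congr rfl fun k _ => mul_left_comm _ _ _)

theorem critVariation_sum {κ : Type*} {t : Finset κ} {f : κ → 𝕜 → 𝕜}
    (hf : ∀ k ∈ t, DifferentiableAt 𝕜 (f k) c) :
    critVariation p c m (fun z => ∑ k ∈ t, f k z) = ∑ k ∈ t, critVariation p c m (f k) := by
  simp only [critVariation, deriv_fun_sum hf, Finset.mul_sum, Finset.sum_add_distrib,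
    Finset.sum_div]
  rw [Finset.sum_comm]

theorem critVariation_comp_eval (hc : (derivative p).eval c = 0)
    (hf : DifferentiableAt 𝕜 f (p.eval c)) :
    critVariation p c m (fun z => f (p.eval z)) =
      ∑ k ∈ Finset.range m, orbitWeight p c m (k + 1) * f ((p.eval ·)^[k + 1] c) := by
  have hderiv : deriv (fun z => f (p.eval z)) c = 0 := by
    have := hf.hasDerivAt.comp c (p.hasDerivAt c)
    rw [hc, mul_zero] at this
    exact this.deriv
  simp only [critVariation, hderiv, zero_div, zero_add, Function.iterate_succ_apply']

theorem IsSimplePeriodicCritPt.critVariation_derivative_mul (h : IsSimplePeriodicCritPt p c m)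
    (hf : DifferentiableAt 𝕜 f c) :
    critVariation p c m (fun z => (derivative p).eval z * f z) =
      ∑ k ∈ Finset.range m, orbitWeight p c m (k + 1) * f ((p.eval ·)^[k + 1] c) := by
  have hderiv : deriv (fun z => (derivative p).eval z * f z) c =
      (derivative (derivative p)).eval c * f c := by
    rw [deriv_fun_mul (derivative p).differentiableAt hf, Polynomial.deriv, h.crit, zero_mul,
      add_zero]
  have hweight : ∀ k ∈ Finset.range m, orbitWeight p c m (k + 1) *
      ((derivative p).eval ((p.eval ·)^[k] c) * f ((p.eval ·)^[k] c)) =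
      orbitWeight p c m k * f ((p.eval ·)^[k] c) := fun k hk => by
    rw [orbitWeight_eq_mul p c (Finset.mem_range.1 hk)]
    ring
  have hzero : orbitWeight p c m 0 = 0 := by
    rw [orbitWeight_eq_mul p c h.pos, Function.iterate_zero_apply, h.crit, zero_mul]
  have hlast : orbitWeight p c m m * f ((p.eval ·)^[m] c) = f c := by
    rw [orbitWeight_self, h.periodic.eq, one_mul]
  have htelescope := Finset.sum_range_succ'
    (fun k => orbitWeight p c m k * f ((p.eval ·)^[k] c)) m
  rw [Finset.sum_range_succ, hlast, hzero, zero_mul, add_zero] at htelescope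
  rw [critVariation, hderiv, mul_div_cancel_left₀ _ h.simple, Finset.sum_congr rfl hweight,
    add_comm, htelescope]

-- The direction `p' ξ - ξ ∘ p` is the velocity of `p` when conjugated along the vector field `ξ`.
theorem IsSimplePeriodicCritPt.critVariation_coboundary (h : IsSimplePeriodicCritPt p c m)
    (hf : DifferentiableAt 𝕜 f c) (hf' : DifferentiableAt 𝕜 f (p.eval c)) :
    critVariation p c m (fun z => (derivative p).eval z * f z - f (p.eval z)) = 0 := by
  rw [critVariation_sub ((derivative p).differentiableAt.fun_mul hf)
    (hf'.fun_comp' c p.differentiableAt), h.critVariation_derivative_mul hf,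
    critVariation_comp_eval h.crit hf', sub_self]

end CritVariation

/-- The rational function `∑ k < m, w k / (p^[k + 1] c - y)` of `y`, where `w k` is the derivative
of `p^[m - k - 1]` at `p^[k + 1] c`: as a quadratic differential with simple poles along the cycle
of `c`, it represents the functional `critVariation p c m`. -/
noncomputable def cycleDifferential (p : ℂ[X]) (c : ℂ) (m : ℕ) : ℂ → ℂ :=
  cauchyTransform (fun k : Fin m => orbitWeight p c m (k + 1)) fun k => (p.eval ·)^[k + 1] c

section CycleDifferential

variable {p : ℂ[X]} {c : ℂ} {m : ℕ}

theorem cycleDifferential_apply (y : ℂ) : cycleDifferential p c m y =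
    ∑ k ∈ Finset.range m, orbitWeight p c m (k + 1) * ((p.eval ·)^[k + 1] c - y)⁻¹ := by
  simp only [cycleDifferential, cauchyTransform, Finset.sum_range, div_eq_mul_inv]

theorem critVariation_inv_eval_sub (hc : (derivative p).eval c = 0) {y : ℂ} (hy : p.eval c ≠ y) :
    critVariation p c m (fun z => (p.eval z - y)⁻¹) = cycleDifferential p c m y := by
  rw [cycleDifferential_apply]
  exact critVariation_comp_eval (f := fun z => (z - y)⁻¹) hc
    (differentiableAt_inv_sub hy)

theorem IsSimplePeriodicCritPt.critVariation_derivative_divByMonic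
    (h : IsSimplePeriodicCritPt p c m) {u : ℂ} (hu : ∀ k < m, (p.eval ·)^[k] c ≠ u) :
    critVariation p c m (fun z => (derivative p /ₘ (X - C u)).eval z) =
      cycleDifferential p c m u -
        (derivative p).eval u * critVariation p c m fun z => (z - u)⁻¹ := by
  have hcu : c ≠ u := hu 0 h.pos
  have hdivision : ∀ z, z ≠ u → (derivative p /ₘ (X - C u)).eval z =
      (derivative p).eval z * (z - u)⁻¹ - (derivative p).eval u * (z - u)⁻¹ := fun z hz => by
    have := congrArg (eval z) (modByMonic_add_div (derivative p) (X - C u))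
    rw [modByMonic_X_sub_C_eq_C_eval, eval_add, eval_C, eval_mul, eval_sub, eval_X, eval_C] at this
    rw [← this]
    field_simp [sub_ne_zero.2 hz]
    ring
  have hinv : DifferentiableAt ℂ (fun z => (z - u)⁻¹) c := differentiableAt_inv_sub hcu
  rw [critVariation_congr ((eventually_ne_nhds hcu).mono hdivision)
    fun k hk => hdivision _ (hu k hk),
    critVariation_sub ((derivative p).differentiableAt.fun_mul hinv) (hinv.const_mul _),
    critVariation_const_mul, h.critVariation_derivative_mul hinv,
    cycleDifferential_apply]

theorem critVariation_inv_eval_sub_eq_sum_roots (hp : 0 < p.natDegree) {y : ℂ}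
    (hy : ∀ k < m, (p.eval ·)^[k + 1] c ≠ y) (hcy : p.eval c ≠ y)
    (hcrit : ∀ u, (derivative p).eval u = 0 → p.eval u ≠ y) :
    critVariation p c m (fun z => (p.eval z - y)⁻¹) = ∑ u ∈ (p - C y).roots.toFinset,
      ((derivative p).eval u)⁻¹ * critVariation p c m fun z => (z - u)⁻¹ := by
  have hnodup : (p - C y).roots.Nodup := nodup_roots_of_eval_derivative_ne_zero fun u hu hu' =>
    hcrit u (by simpa using hu') (by simpa [sub_eq_zero] using hu)
  have hfrac : ∀ z, p.eval z ≠ y → (p.eval z - y)⁻¹ =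
      ∑ u ∈ (p - C y).roots.toFinset, ((derivative p).eval u)⁻¹ * (z - u)⁻¹ := fun z hz => by
    have := inv_eval_eq_sum_roots (IsAlgClosed.splits (p - C y)) (by rwa [natDegree_sub_C]) hnodup
      (z := z) (by simpa [sub_eq_zero] using hz)
    simpa using this
  have hroot : ∀ u ∈ (p - C y).roots.toFinset, c ≠ u := by
    rintro u hu rfl
    have := (mem_roots'.1 (Multiset.mem_toFinset.1 hu)).2
    exact hcy (by simpa [sub_eq_zero] using this)
  rw [critVariation_congr ((p.continuous.continuousAt.eventually_ne hcy).mono hfrac)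
    fun k hk => hfrac _ (by simpa only [Function.iterate_succ_apply'] using hy k hk),
    critVariation_sum fun u hu => (differentiableAt_inv_sub (hroot u hu)).const_mul _]
  simp only [critVariation_const_mul]

theorem IsSimplePeriodicCritPt.tendsto_sub_mul_cycleDifferential (h : IsSimplePeriodicCritPt p c m)
    {c' : ℂ} (hc' : (derivative p).eval c' = 0) :
    Tendsto (fun z => (c' - z) * cycleDifferential p c m z) (𝓝[≠] c')
      (𝓝 (if c = c' then 1 else 0)) := by
  have hresidue : ∑ k ∈ Finset.univ.filter fun k : Fin m => (p.eval ·)^[(k : ℕ) + 1] c = c',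
      orbitWeight p c m (k + 1) = if c = c' then 1 else 0 := by
    obtain ⟨n, rfl⟩ := Nat.exists_eq_add_of_le' h.pos
    rw [Finset.sum_filter, Fin.sum_univ_castSucc, Fin.val_last, orbitWeight_self, h.periodic.eq]
    refine add_eq_right.2 (Finset.sum_eq_zero fun k _ => ?_)
    rw [ite_eq_right_iff, Fin.val_castSucc]
    intro hk
    rw [orbitWeight_eq_mul p c (by omega), hk, hc', zero_mul]
  exact hresidue ▸ tendsto_sub_mul_cauchyTransform _ _ c'

end CycleDifferential

section Independence

variable {ι : Type*} [Fintype ι] {p : ℂ[X]} {c : ι → ℂ} {m : ι → ℕ} {l : ι → ℂ}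

theorem sum_cycleDifferential_eq_derivative_mul (hp : 2 ≤ p.natDegree)
    (h : ∀ i, IsSimplePeriodicCritPt p (c i) (m i))
    (hl : ∀ g : ℂ[X], g.natDegree + 2 ≤ p.natDegree →
      ∑ i, l i * critVariation p (c i) (m i) (fun z => g.eval z) = 0)
    {u : ℂ} (hu : ∀ i, ∀ k < m i, (p.eval ·)^[k] (c i) ≠ u) :
    ∑ i, l i * cycleDifferential p (c i) (m i) u =
      (derivative p).eval u * ∑ i, l i * critVariation p (c i) (m i) fun z => (z - u)⁻¹ := by
  have hdeg : (derivative p /ₘ (X - C u)).natDegree + 2 ≤ p.natDegree := by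
    rw [natDegree_divByMonic _ (monic_X_sub_C u), natDegree_X_sub_C]
    have := natDegree_derivative_le p
    omega
  have hkill := hl _ hdeg
  simp only [(h _).critVariation_derivative_divByMonic (hu _), mul_sub,
    Finset.sum_sub_distrib] at hkill
  rw [sub_eq_zero.1 hkill, Finset.mul_sum]
  exact Finset.sum_congr rfl fun i _ => mul_left_comm _ _ _

theorem sum_cycleDifferential_eq_quadPushforward (hp : 2 ≤ p.natDegree)
    (h : ∀ i, IsSimplePeriodicCritPt p (c i) (m i))
    (hl : ∀ g : ℂ[X], g.natDegree + 2 ≤ p.natDegree →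
      ∑ i, l i * critVariation p (c i) (m i) (fun z => g.eval z) = 0)
    {y : ℂ} (hy : ∀ i, ∀ k < m i, (p.eval ·)^[k + 1] (c i) ≠ y)
    (hcrit : ∀ u, (derivative p).eval u = 0 → p.eval u ≠ y) :
    ∑ i, l i * cycleDifferential p (c i) (m i) y =
      quadPushforward p (fun u => ∑ i, l i * cycleDifferential p (c i) (m i) u) y := by
  have hroot : ∀ u ∈ (p - C y).roots.toFinset, p.eval u = y := fun u hu => by
    simpa [sub_eq_zero] using (mem_roots'.1 (Multiset.mem_toFinset.1 hu)).2
  have horbit : ∀ u ∈ (p - C y).roots.toFinset, ∀ i, ∀ k < m i, (p.eval ·)^[k] (c i) ≠ u := by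
    rintro _ hu i k hk rfl
    exact hy i k hk ((Function.iterate_succ_apply' _ _ _).trans (hroot _ hu))
  have hcy : ∀ i, p.eval (c i) ≠ y := fun i => hcrit _ (h i).crit
  calc ∑ i, l i * cycleDifferential p (c i) (m i) y
      = ∑ i, l i * ∑ u ∈ (p - C y).roots.toFinset, ((derivative p).eval u)⁻¹ *
          critVariation p (c i) (m i) fun z => (z - u)⁻¹ := by
        simp only [← critVariation_inv_eval_sub (h _).crit (hcy _),
          critVariation_inv_eval_sub_eq_sum_roots (by omega) (hy _) (hcy _) hcrit]
    _ = ∑ u ∈ (p - C y).roots.toFinset, ((derivative p).eval u)⁻¹ *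
          ∑ i, l i * critVariation p (c i) (m i) fun z => (z - u)⁻¹ := by
        simp only [Finset.mul_sum, mul_left_comm (l _)]
        exact Finset.sum_comm
    _ = quadPushforward p (fun u => ∑ i, l i * cycleDifferential p (c i) (m i) u) y := by
        refine Finset.sum_congr rfl fun u hu => ?_
        have hu' : (derivative p).eval u ≠ 0 := fun h0 => hcrit u h0 (hroot u hu)
        simp only [sum_cycleDifferential_eq_derivative_mul hp h hl (horbit u hu)]
        field_simp

theorem eqOn_sum_cycleDifferential_zero (hp : 2 ≤ p.natDegree)
    (h : ∀ i, IsSimplePeriodicCritPt p (c i) (m i))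
    (hl : ∀ g : ℂ[X], g.natDegree + 2 ≤ p.natDegree →
      ∑ i, l i * critVariation p (c i) (m i) (fun z => g.eval z) = 0) :
    Set.EqOn (fun y => ∑ i, l i * cycleDifferential p (c i) (m i) y) 0
      (⋃ i, Set.range fun k : Fin (m i) => (p.eval ·)^[k + 1] (c i))ᶜ := by
  set F : Set ℂ := ⋃ i, Set.range fun k : Fin (m i) => (p.eval ·)^[k + 1] (c i)
  have hF : F.Finite := Set.finite_iUnion fun i => Set.finite_range _
  have hcritval : ((fun z => p.eval z) '' {u | (derivative p).eval u = 0}).Finite := by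
    have hp' : derivative p ≠ 0 := fun h0 => by
      have := derivative_eq_zero.1 h0
      omega
    exact (finite_setOfPred_isRoot hp').image _
  refine eqOn_zero_of_ae_eq_quadPushforward hp
    (Finset.measurable_sum _ fun i _ => (measurable_cauchyTransform _ _).const_mul _)
    (locallyIntegrable_finsetSum _ fun i _ =>
      (locallyIntegrable_cauchyTransform _ _).smul (l i)) ?_ hF.countable hF.isClosed
    (.fun_sum fun i _ => ((differentiableOn_cauchyTransform _ _).mono
      (Set.compl_subset_compl.2 (Set.subset_iUnion (fun i => Set.range fun k : Fin (m i) =>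
        (p.eval ·)^[(k : ℕ) + 1] (c i)) i))).const_mul _)
  filter_upwards [(hF.union hcritval).countable.ae_notMem volume] with y hy
  refine sum_cycleDifferential_eq_quadPushforward hp h hl (fun i k hk hky => hy (Or.inl ?_))
    fun u hu huy => hy (Or.inr ⟨u, hu, huy⟩)
  exact Set.mem_iUnion.2 ⟨i, ⟨k, hk⟩, hky⟩

theorem eq_zero_of_sum_critVariation_eq_zero (hp : 2 ≤ p.natDegree) (hinj : Function.Injective c)
    (h : ∀ i, IsSimplePeriodicCritPt p (c i) (m i))
    (hl : ∀ g : ℂ[X], g.natDegree + 2 ≤ p.natDegree →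
      ∑ i, l i * critVariation p (c i) (m i) (fun z => g.eval z) = 0) : l = 0 := by
  classical
  funext j
  have hresidue : Tendsto (fun z => ∑ i, l i * ((c j - z) * cycleDifferential p (c i) (m i) z))
      (𝓝[≠] c j) (𝓝 (l j)) := by
    have := tendsto_finsetSum Finset.univ fun i _ =>
      ((h i).tendsto_sub_mul_cycleDifferential (h j).crit).const_mul (l i)
    simpa [hinj.eq_iff] using this
  refine tendsto_nhds_unique hresidue (tendsto_const_nhds.congr' ?_)
  set F : Set ℂ := ⋃ i, Set.range fun k : Fin (m i) => (p.eval ·)^[k + 1] (c i)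
  have hF : (F \ {c j})ᶜ ∈ 𝓝 (c j) :=
    ((Set.finite_iUnion fun i => Set.finite_range _).sdiff.isClosed.isOpen_compl).mem_nhds (by simp)
  filter_upwards [self_mem_nhdsWithin, nhdsWithin_le_nhds hF] with z hz hzF
  have hzero := eqOn_sum_cycleDifferential_zero hp h hl (x := z) fun hmem => hzF ⟨hmem, hz⟩
  simp only [Pi.zero_apply] at hzero
  simp only [mul_left_comm (l _), ← Finset.mul_sum, hzero, mul_zero, Pi.zero_apply]

end Independence

/-! ### Iterating a linear family of polynomials -/

section LinearFamily

variable {𝕜 E : Type*} [NontriviallyNormedField 𝕜] [CompleteSpace 𝕜] [NormedAddCommGroup E]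
  [NormedSpace 𝕜 E] [FiniteDimensional 𝕜 E] (T : E →ₗ[𝕜] 𝕜[X])

/-- Evaluation at `z` of the members of a linear family of polynomials, as a continuous linear form
on the parameters. -/
noncomputable def evalCLM (z : 𝕜) : E →L[𝕜] 𝕜 :=
  LinearMap.toContinuousLinearMap (leval z ∘ₗ T)

theorem evalCLM_apply (z : 𝕜) (Q : E) : evalCLM T z Q = (T Q).eval z := rfl

theorem contDiff_eval : ContDiff 𝕜 ω fun x : E × 𝕜 => (T x.1).eval x.2 := by
  set b := Module.finBasis 𝕜 E
  have hcoord : (fun x : E × 𝕜 => (T x.1).eval x.2) =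
      fun x => ∑ i, b.coord i x.1 * (T (b i)).eval x.2 := funext fun x => by
    conv_lhs => rw [← b.sum_repr x.1, map_sum, eval_finsetSum]
    exact Finset.sum_congr rfl fun i _ => by rw [map_smul, eval_smul, smul_eq_mul, b.coord_apply]
  rw [hcoord]
  refine ContDiff.sum fun i _ => ContDiff.mul ?_ ?_
  · exact (LinearMap.toContinuousLinearMap (b.coord i)).contDiff.comp contDiff_fst
  · exact (contDiff_aeval (𝕜 := 𝕜) (T (b i)) ω).comp contDiff_snd

variable {T} {γ : E → 𝕜} {γ' : E →L[𝕜] 𝕜} {P : E}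

theorem hasFDerivAt_eval (hγ : HasFDerivAt γ γ' P) :
    HasFDerivAt (fun Q => (T Q).eval (γ Q))
      (evalCLM T (γ P) + (derivative (T P)).eval (γ P) • γ') P := by
  have hjoint := ((contDiff_eval T).differentiable (by simp) (P, γ P)).hasFDerivAt
  have hcomp := hjoint.comp P ((hasFDerivAt_id P).prodMk hγ)
  have hfst := (hjoint.comp (f := fun Q => (Q, γ P)) P
    ((hasFDerivAt_id P).prodMk (hasFDerivAt_const (γ P) P))).unique (evalCLM T (γ P)).hasFDerivAt
  have hsnd := (hjoint.comp_hasDerivAt (γ P)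
    ((hasDerivAt_const (γ P) P).prodMk (hasDerivAt_id (γ P)))).unique ((T P).hasDerivAt (γ P))
  refine hcomp.congr_fderiv (ContinuousLinearMap.ext fun v => ?_)
  have hsplit : (v, γ' v) = (v, (0 : 𝕜)) + γ' v • ((0 : E), (1 : 𝕜)) := by simp
  have hv := congrArg (fun L => L v) hfst
  simp only [ContinuousLinearMap.comp_apply, ContinuousLinearMap.prod_apply,
    ContinuousLinearMap.id_apply, zero_apply] at hv
  simp only [ContinuousLinearMap.comp_apply, ContinuousLinearMap.prod_apply,
    ContinuousLinearMap.id_apply, add_apply, smul_apply]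
  rw [hsplit, map_add, map_smul, hsnd, hv, smul_eq_mul, smul_eq_mul, mul_comm]

theorem hasFDerivAt_iterate_eval (hγ : HasFDerivAt γ γ' P) (m : ℕ) :
    HasFDerivAt (fun Q => ((T Q).eval ·)^[m] (γ Q))
      (∑ k ∈ Finset.range m, orbitWeight (T P) (γ P) m (k + 1) •
        evalCLM T (((T P).eval ·)^[k] (γ P)) + orbitWeight (T P) (γ P) m 0 • γ') P := by
  induction m with
  | zero => simpa [orbitWeight] using hγ
  | succ m ih =>
    have hweight : ∀ k ∈ Finset.range m, orbitWeight (T P) (γ P) (m + 1) (k + 1) •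
        evalCLM T (((T P).eval ·)^[k] (γ P)) =
        (derivative (T P)).eval (((T P).eval ·)^[m] (γ P)) •
          orbitWeight (T P) (γ P) m (k + 1) • evalCLM T (((T P).eval ·)^[k] (γ P)) :=
      fun k hk => by rw [orbitWeight_succ _ _ (Finset.mem_range.1 hk), smul_smul]
    simp only [Function.iterate_succ_apply']
    refine (hasFDerivAt_eval ih).congr_fderiv ?_
    rw [Finset.sum_range_succ, Finset.sum_congr rfl hweight, orbitWeight_self, one_smul, smul_add,
      smul_smul, ← orbitWeight_succ _ _ m.zero_le, Finset.smul_sum]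
    abel

theorem contDiffAt_iterate_eval (hγ : ContDiffAt 𝕜 ω γ P) (m : ℕ) :
    ContDiffAt 𝕜 ω (fun Q => ((T Q).eval ·)^[m] (γ Q)) P := by
  induction m with
  | zero => exact hγ
  | succ m ih =>
    simp only [Function.iterate_succ_apply']
    exact (contDiff_eval T).contDiffAt.comp P (contDiffAt_id.prodMk ih)

theorem fderiv_critPt_apply (hγ : DifferentiableAt 𝕜 γ P)
    (hcrit : ∀ᶠ Q in 𝓝 P, (derivative (T Q)).eval (γ Q) = 0)
    (hsimple : (derivative (derivative (T P))).eval (γ P) ≠ 0) (v : E) :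
    fderiv 𝕜 γ P v =
      -((derivative (T v)).eval (γ P) / (derivative (derivative (T P))).eval (γ P)) := by
  have hzero := (hasFDerivAt_eval (T := derivative ∘ₗ T) hγ.hasFDerivAt).unique
    ((hasFDerivAt_const (0 : 𝕜) P).congr_of_eventuallyEq hcrit)
  have hv := congrArg (fun L => L v) hzero
  simp only [add_apply, smul_apply, smul_eq_mul, evalCLM_apply, zero_apply,
    LinearMap.comp_apply] at hv
  rw [← neg_div, eq_div_iff hsimple]
  linear_combination hv

variable (T γ) in
/-- The function `Q ↦ Q^[m] (γ Q) - γ Q`, which vanishes where `m` is a period of the marked point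
`γ Q`. -/
noncomputable def returnDefect (m : ℕ) (Q : E) : 𝕜 := ((T Q).eval ·)^[m] (γ Q) - γ Q

theorem contDiffAt_returnDefect (hγ : ContDiffAt 𝕜 ω γ P) (m : ℕ) :
    ContDiffAt 𝕜 ω (returnDefect T γ m) P :=
  (contDiffAt_iterate_eval hγ m).sub hγ

theorem differentiableAt_iterate_eval (hγ : DifferentiableAt 𝕜 γ P) (m : ℕ) :
    DifferentiableAt 𝕜 (fun Q => ((T Q).eval ·)^[m] (γ Q)) P :=
  (hasFDerivAt_iterate_eval hγ.hasFDerivAt m).differentiableAt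

theorem fderiv_returnDefect_apply {m : ℕ} (h : IsSimplePeriodicCritPt (T P) (γ P) m)
    (hγ : DifferentiableAt 𝕜 γ P) (hcrit : ∀ᶠ Q in 𝓝 P, (derivative (T Q)).eval (γ Q) = 0)
    (v : E) :
    fderiv 𝕜 (returnDefect T γ m) P v =
      critVariation (T P) (γ P) m fun z => (T v).eval z := by
  have hzero : orbitWeight (T P) (γ P) m 0 = 0 := by
    rw [orbitWeight_eq_mul _ _ h.pos, Function.iterate_zero_apply, h.crit, zero_mul]
  have hderiv : HasFDerivAt (returnDefect T γ m) _ P :=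
    (hasFDerivAt_iterate_eval hγ.hasFDerivAt m).sub hγ.hasFDerivAt
  rw [hzero, zero_smul 𝕜 (fderiv 𝕜 γ P), add_zero] at hderiv
  rw [hderiv.fderiv, sub_apply, sum_apply,
    fderiv_critPt_apply hγ hcrit h.simple, sub_neg_eq_add, add_comm, critVariation,
    Polynomial.deriv]
  rfl

end LinearFamily

section Coefficients

variable {d : ℕ}

variable (d) in
/-- The map `toPoly`, as a linear family of polynomials. -/
noncomputable def toPolyₗ : (Fin (d + 1) → ℂ) →ₗ[ℂ] ℂ[X] where
  toFun := toPoly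
  map_add' b b' := by simp only [toPoly, Pi.add_apply, C_add, add_mul, Finset.sum_add_distrib]
  map_smul' a b := by
    simp only [toPoly, Pi.smul_apply, smul_eq_mul, C_mul, mul_assoc, RingHom.id_apply,
      smul_eq_C_mul, Finset.mul_sum]

theorem toPolyₗ_apply (b : Fin (d + 1) → ℂ) : toPolyₗ d b = toPoly b := rfl

variable (d) in
/-- The vector of the coefficients of degree at most `d` of a polynomial. -/
noncomputable def coeffVec : ℂ[X] →ₗ[ℂ] (Fin (d + 1) → ℂ) :=
  LinearMap.pi fun i => lcoeff ℂ i

theorem toPoly_coeffVec {g : ℂ[X]} (hg : g.natDegree ≤ d) : toPoly (coeffVec d g) = g := by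
  conv_rhs => rw [as_sum_range_C_mul_X_pow' g (Nat.lt_succ_of_le hg)]
  exact Fin.sum_univ_eq_sum_range (fun i => C (g.coeff i) * X ^ i) (d + 1)

theorem coeff_toPoly (b : Fin (d + 1) → ℂ) (i : Fin (d + 1)) : (toPoly b).coeff i = b i := by
  simp [toPoly, finsetSum_coeff, coeff_C_mul, coeff_X_pow, ← Fin.ext_iff]

theorem coeffVec_toPoly (b : Fin (d + 1) → ℂ) : coeffVec d (toPoly b) = b :=
  funext (coeff_toPoly b)

theorem toPoly_injective : Function.Injective (toPoly (d := d)) :=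
  Function.LeftInverse.injective coeffVec_toPoly

theorem natDegree_toPoly_le (b : Fin (d + 1) → ℂ) : (toPoly b).natDegree ≤ d :=
  natDegree_sum_le_of_forall_le _ _ fun i _ =>
    (natDegree_C_mul_X_pow_le _ _).trans (Nat.lt_succ_iff.1 i.2)

theorem natDegree_toPoly {b : Fin (d + 1) → ℂ} (hb : b ∈ PolyD d) : (toPoly b).natDegree = d :=
  le_antisymm (natDegree_toPoly_le b)
    (le_natDegree_of_ne_zero ((coeff_toPoly b (Fin.last d)).trans_ne hb))

theorem isOpen_polyD : IsOpen (PolyD d) :=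
  isOpen_ne.preimage (continuous_apply (Fin.last d))

theorem natDegree_derivative_toPoly {b : Fin (d + 1) → ℂ} (hb : b ∈ PolyD d) :
    (derivative (toPoly b)).natDegree = d - 1 := by
  rw [natDegree_derivative, natDegree_toPoly hb]

end Coefficients

/-! ### Tangent vectors of zero sets -/

theorem exists_implicit {𝕜 E : Type*} [RCLike 𝕜] [NormedAddCommGroup E] [NormedSpace 𝕜 E]
    [CompleteSpace E] {f : E × 𝕜 → 𝕜} {x : E} {z : 𝕜} (hf : ContDiffAt 𝕜 ω f (x, z))
    (h0 : f (x, z) = 0) (hne : fderiv 𝕜 f (x, z) (0, 1) ≠ 0) :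
    ∃ ψ : E → 𝕜, ContDiffAt 𝕜 ω ψ x ∧ ψ x = z ∧ (∀ᶠ y in 𝓝 x, f (y, ψ y) = 0) ∧
      ∀ᶠ y in 𝓝 (x, z), f y = 0 → ψ y.1 = y.2 := by
  have hinv : (fderiv 𝕜 f (x, z) ∘L .inr 𝕜 E 𝕜).IsInvertible :=
    ⟨ContinuousLinearEquiv.unitsEquivAut 𝕜 (Units.mk0 _ hne), by ext; simp⟩
  refine ⟨hf.implicitFunction (by simp) hinv, hf.contDiffAt_implicitFunction (by simp) hinv,
    hf.implicitFunction_apply_self (by simp) hinv, ?_, ?_⟩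
  · filter_upwards [hf.eventually_apply_implicitFunction (by simp) hinv] with y hy
    rw [hy, h0]
  · filter_upwards [hf.eventually_apply_eq_iff_implicitFunction (by simp) hinv] with y hy hy0
    exact hy.1 (hy0.trans h0.symm)

section TangentVectors

variable {E : Type*} [NormedAddCommGroup E] [NormedSpace ℂ E] {S : Set E} {x v : E}

theorem mem_tangentVectors_of_eventually {γ : ℂ → E} (hγ : ∀ᶠ t in 𝓝 0, DifferentiableAt ℂ γ t)
    (hS : ∀ᶠ t in 𝓝 0, γ t ∈ S) (h0 : γ 0 = x) (hv : deriv γ 0 = v) : v ∈ tangentVectors S x := by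
  obtain ⟨r, hr, hball⟩ := Metric.eventually_nhds_iff_ball.1 (hγ.and hS)
  exact ⟨γ, r, hr, fun t ht => (hball t ht).1.differentiableWithinAt,
    fun t ht => (hball t ht).2, h0, hv⟩

theorem fderiv_apply_eq_zero_of_mem_tangentVectors {F : Type*} [NormedAddCommGroup F]
    [NormedSpace ℂ F] {g : E → F} (hg : DifferentiableAt ℂ g x)
    (hS : ∀ᶠ y in 𝓝 x, y ∈ S → g y = 0) (hv : v ∈ tangentVectors S x) : fderiv ℂ g x v = 0 := by
  obtain ⟨γ, r, hr, hγ, hγS, rfl, rfl⟩ := hv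
  have hball : Metric.ball (0 : ℂ) r ∈ 𝓝 0 := Metric.ball_mem_nhds 0 hr
  have hγ0 : DifferentiableAt ℂ γ 0 := hγ.differentiableAt hball
  have hcomp := hg.hasFDerivAt.comp_hasDerivAt 0 hγ0.hasDerivAt
  refine hcomp.unique ((hasDerivAt_const 0 0).congr_of_eventuallyEq ?_)
  filter_upwards [hball, hγ0.continuousAt.eventually hS] with t ht htS
  exact htS (hγS t ht)

theorem exists_contDiffAt_eq_zero_along {g : E → ℂ} (hg : ContDiffAt ℂ ω g x)
    (hx : g x = 0) (v : E) {u : E} (hu : fderiv ℂ g x u ≠ 0) :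
    ∃ ψ : ℂ → ℂ, ContDiffAt ℂ ω ψ 0 ∧ ψ 0 = 0 ∧ ∀ᶠ t in 𝓝 0, g (x + t • v + ψ t • u) = 0 := by
  let A : ℂ × ℂ → E := fun s => x + s.1 • v + s.2 • u
  have hA : ContDiff ℂ ω A := by fun_prop
  have hA0 : A (0, 0) = x := by simp [A]
  have hgA : ContDiffAt ℂ ω (g ∘ A) (0, 0) := ContDiffAt.comp _ (by rwa [hA0]) hA.contDiffAt
  have hAu : HasDerivAt (fun s : ℂ => A (0, s)) u 0 := by
    simpa [A] using ((hasDerivAt_id (0 : ℂ)).smul_const u).const_add x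
  have hpair : HasDerivAt (fun s : ℂ => ((0 : ℂ), s)) (0, 1) 0 :=
    (hasDerivAt_const _ _).prodMk (hasDerivAt_id 0)
  have hgd : HasFDerivAt g (fderiv ℂ g x) (A (0, 0)) :=
    hA0.symm ▸ (hg.differentiableAt (by simp)).hasFDerivAt
  have hpartial : fderiv ℂ (g ∘ A) (0, 0) (0, 1) = fderiv ℂ g x u :=
    ((hgA.differentiableAt (by simp)).hasFDerivAt.comp_hasDerivAt 0 hpair).unique
      (hgd.comp_hasDerivAt 0 hAu)
  obtain ⟨ψ, hψ, hψ0, hψz, -⟩ := exists_implicit hgA (by simp [hA0, hx]) (hpartial.trans_ne hu)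
  exact ⟨ψ, hψ, hψ0, hψz⟩

theorem mem_tangentVectors_of_fderiv_apply_eq_zero {g : E → ℂ}
    (hg : ContDiffAt ℂ ω g x) (hx : g x = 0) (hne : fderiv ℂ g x ≠ 0)
    (hS : ∀ᶠ y in 𝓝 x, g y = 0 → y ∈ S) (hv : fderiv ℂ g x v = 0) : v ∈ tangentVectors S x := by
  obtain ⟨u, hu⟩ := DFunLike.ne_iff.1 hne
  obtain ⟨ψ, hψ, hψ0, hψg⟩ := exists_contDiffAt_eq_zero_along hg hx v hu
  set γ : ℂ → E := fun t => x + t • v + ψ t • u with hγ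
  have hγ0 : γ 0 = x := by simp [hγ, hψ0]
  have hγd : HasDerivAt γ (v + deriv ψ 0 • u) 0 := by
    simpa [hγ] using (((hasDerivAt_id (0 : ℂ)).smul_const v).const_add x).fun_add
      ((hψ.differentiableAt (by simp)).hasDerivAt.smul_const u)
  have hψ' : deriv ψ 0 = 0 := by
    have hgd : HasFDerivAt g (fderiv ℂ g x) (γ 0) :=
      hγ0.symm ▸ (hg.differentiableAt (by simp)).hasFDerivAt
    have hzero := (hgd.comp_hasDerivAt 0 hγd).unique
      ((hasDerivAt_const 0 0).congr_of_eventuallyEq hψg)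
    rw [map_add, map_smul, hv, zero_add, smul_eq_mul] at hzero
    exact (mul_eq_zero.1 hzero).resolve_right hu
  refine mem_tangentVectors_of_eventually (γ := γ) ?_ ?_ hγ0 ?_
  · filter_upwards [hψ.eventually (by simp)] with t ht
    have := ht.differentiableAt (by simp)
    fun_prop
  · filter_upwards [hψg, hγd.continuousAt.eventually (hγ0.symm ▸ hS)] with t ht htS using htS ht
  · rw [hγd.deriv, hψ', zero_smul, add_zero]

theorem tangentVectors_eq_ker_fderiv {g : E → ℂ} (hg : ContDiffAt ℂ ω g x)
    (hx : g x = 0) (hne : fderiv ℂ g x ≠ 0) (hS : ∀ᶠ y in 𝓝 x, (y ∈ S ↔ g y = 0)) :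
    tangentVectors S x = (fderiv ℂ g x).ker :=
  Set.Subset.antisymm
    (fun _ hv => fderiv_apply_eq_zero_of_mem_tangentVectors (hg.differentiableAt (by simp))
      (hS.mono fun _ => Iff.mp) hv)
    fun _ hv => mem_tangentVectors_of_fderiv_apply_eq_zero hg hx hne (hS.mono fun _ => Iff.mpr) hv

end TangentVectors

theorem finrank_iInf_ker_add_card {K E ι : Type*} [Field K] [AddCommGroup E] [Module K E]
    [FiniteDimensional K E] [Fintype ι] {φ : ι → Module.Dual K E} (hφ : LinearIndependent K φ) :
    Module.finrank K (⨅ i, LinearMap.ker (φ i) : Submodule K E) + Fintype.card ι =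
      Module.finrank K E := by
  have hker : (⨅ i, LinearMap.ker (φ i) : Submodule K E) =
      (Submodule.span K (Set.range φ)).dualCoannihilator := by
    apply SetLike.coe_injective
    rw [Submodule.coe_dualCoannihilator_span]
    ext v
    simp
  rw [hker, add_comm, ← finrank_span_eq_card hφ]
  exact Subspace.finrank_add_finrank_dualCoannihilator_eq _

theorem finrank_iInf_ker_clm_add_card {K E ι : Type*} [NontriviallyNormedField K]
    [NormedAddCommGroup E] [NormedSpace K E] [FiniteDimensional K E] [Fintype ι]
    {φ : ι → E →L[K] K} (hφ : LinearIndependent K φ) :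
    Module.finrank K (⨅ i, (φ i).ker : Submodule K E) + Fintype.card ι = Module.finrank K E :=
  finrank_iInf_ker_add_card (hφ.map' (ContinuousLinearMap.coeLM K)
    (LinearMap.ker_eq_bot.2 ContinuousLinearMap.coe_injective))

/-! ### Marked critical points -/

section CriticalPoints

variable {d : ℕ} {Q : Fin (d + 1) → ℂ}

theorem critSet_eq_coe_toFinset_roots (hd : 2 ≤ d) (hQ : Q ∈ PolyD d) :
    critSet Q = (derivative (toPoly Q)).roots.toFinset := by
  have hne : derivative (toPoly Q) ≠ 0 := ne_zero_of_natDegree_gt (n := 0) <| by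
    rw [natDegree_derivative_toPoly hQ]
    omega
  ext z
  simp [critSet, hne]

theorem finite_critSet (hd : 2 ≤ d) (hQ : Q ∈ PolyD d) : (critSet Q).Finite :=
  critSet_eq_coe_toFinset_roots hd hQ ▸ Finset.finite_toSet _

theorem ncard_critSet_le (hd : 2 ≤ d) (hQ : Q ∈ PolyD d) : (critSet Q).ncard ≤ d - 1 := by
  rw [critSet_eq_coe_toFinset_roots hd hQ, Set.ncard_coe_finset, ← natDegree_derivative_toPoly hQ]
  exact (Multiset.toFinset_card_le _).trans (card_roots' _)

theorem ncard_critSet (hd : 2 ≤ d) (hQ : Q ∈ PolyD d) (hsimple : HasSimpleCritPts Q) :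
    (critSet Q).ncard = d - 1 := by
  rw [critSet_eq_coe_toFinset_roots hd hQ, Set.ncard_coe_finset,
    Multiset.toFinset_card_of_nodup (nodup_roots_of_eval_derivative_ne_zero hsimple),
    IsAlgClosed.card_roots_eq_natDegree, natDegree_derivative_toPoly hQ]

theorem range_eq_critSet (hd : 2 ≤ d) (hQ : Q ∈ PolyD d) {z : Fin (d - 1) → ℂ}
    (hinj : Function.Injective z) (hz : ∀ i, z i ∈ critSet Q) : Set.range z = critSet Q := by
  refine Set.eq_of_subset_of_ncard_le (Set.range_subset_iff.2 hz) ?_ (finite_critSet hd hQ)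
  rw [Set.ncard_range_of_injective hinj, Nat.card_fin]
  exact ncard_critSet_le hd hQ

theorem injective_of_range_eq_critSet (hd : 2 ≤ d) (hQ : Q ∈ PolyD d)
    (hsimple : HasSimpleCritPts Q) {z : Fin (d - 1) → ℂ} (hz : Set.range z = critSet Q) :
    Function.Injective z := by
  refine Set.injOn_univ.1 (Set.injOn_of_ncard_image_eq ?_)
  rw [Set.image_univ, hz, ncard_critSet hd hQ hsimple, Set.ncard_univ, Nat.card_fin]

theorem exists_injective_range_eq_critSet (hd : 2 ≤ d) (hQ : Q ∈ PolyD d)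
    (hsimple : HasSimpleCritPts Q) :
    ∃ z : Fin (d - 1) → ℂ, Function.Injective z ∧ Set.range z = critSet Q := by
  have := (finite_critSet hd hQ).to_subtype
  let e := Finite.equivFinOfCardEq (ncard_critSet hd hQ hsimple)
  exact ⟨fun i => e.symm i, Subtype.val_injective.comp e.symm.injective,
    (e.symm.surjective.range_comp _).trans Subtype.range_coe⟩

end CriticalPoints

section Marking

variable {d : ℕ} {P : Fin (d + 1) → ℂ}

theorem exists_critPt_continuation {z : ℂ} (hz : z ∈ critSet P)
    (hz2 : (derivative (derivative (toPoly P))).eval z ≠ 0) :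
    ∃ ψ : (Fin (d + 1) → ℂ) → ℂ, ContDiffAt ℂ ω ψ P ∧ ψ P = z ∧
      (∀ᶠ Q in 𝓝 P, ψ Q ∈ critSet Q) ∧
      ∀ᶠ y in 𝓝 (P, z), y.2 ∈ critSet y.1 → ψ y.1 = y.2 := by
  have hf := (contDiff_eval (derivative ∘ₗ toPolyₗ d)).contDiffAt (x := (P, z))
  refine exists_implicit hf hz ?_
  have hpartial := ((hf.differentiableAt (by simp)).hasFDerivAt.comp_hasDerivAt z
    ((hasDerivAt_const z P).prodMk (hasDerivAt_id z))).unique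
      ((derivative (toPoly P)).hasDerivAt z)
  exact hpartial.trans_ne hz2

theorem eventually_injective_of_continuousAt {ι X Y : Type*} [Finite ι] [TopologicalSpace X]
    [TopologicalSpace Y] [T2Space Y] {ψ : ι → X → Y} {x : X} (hψ : ∀ i, ContinuousAt (ψ i) x)
    (hinj : Function.Injective fun i => ψ i x) :
    ∀ᶠ y in 𝓝 x, Function.Injective fun i => ψ i y := by
  have hne : ∀ᶠ y in 𝓝 x, ∀ i j, i ≠ j → ψ i y ≠ ψ j y :=
    eventually_all.2 fun i => eventually_all.2 fun j => eventually_imp_distrib_left.2 fun hij =>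
      ((hψ i).ne_iff_eventually_ne (hψ j)).1 (hinj.ne hij)
  filter_upwards [hne] with y hy i j using not_imp_not.1 (hy i j)

theorem exists_isCritMarking (hd : 2 ≤ d) (hP : P ∈ PolyD d) (hsimple : HasSimpleCritPts P) :
    ∃ (V : Set (Fin (d + 1) → ℂ)) (c : Fin (d - 1) → (Fin (d + 1) → ℂ) → ℂ),
      IsCritMarking P V c := by
  obtain ⟨z, hinj, hrange⟩ := exists_injective_range_eq_critSet hd hP hsimple
  have hz : ∀ i, z i ∈ critSet P := fun i => hrange ▸ Set.mem_range_self i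
  choose ψ hψ hψP hψcrit _ using fun i => exists_critPt_continuation (hz i) (hsimple _ (hz i))
  have hdiff : ∀ᶠ Q in 𝓝 P, ∀ i, DifferentiableAt ℂ (ψ i) Q := eventually_all.2 fun i =>
    ((hψ i).eventually (by simp)).mono fun Q hQ => hQ.differentiableAt (by simp)
  have hdistinct : ∀ᶠ Q in 𝓝 P, Function.Injective fun i => ψ i Q :=
    eventually_injective_of_continuousAt (fun i => (hψ i).continuousAt) (by simpa only [hψP])
  obtain ⟨V, hV, hVo, hPV⟩ := eventually_nhds_iff.1 ((isOpen_polyD.eventually_mem hP).and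
    (hdiff.and ((eventually_all.2 hψcrit).and hdistinct)))
  exact ⟨V, ψ, hVo, hPV, fun Q hQ => (hV Q hQ).1,
    fun i Q hQ => ((hV Q hQ).2.1 i).differentiableWithinAt,
    fun Q hQ => range_eq_critSet hd (hV Q hQ).1 (hV Q hQ).2.2.2 (hV Q hQ).2.2.1⟩

namespace IsCritMarking

variable {V : Set (Fin (d + 1) → ℂ)} {c : Fin (d - 1) → (Fin (d + 1) → ℂ) → ℂ}

theorem mem_critSet (h : IsCritMarking P V c) {Q : Fin (d + 1) → ℂ} (hQ : Q ∈ V)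
    (i : Fin (d - 1)) : c i Q ∈ critSet Q :=
  h.range_eq Q hQ ▸ Set.mem_range_self i

theorem eventually_mem (h : IsCritMarking P V c) : ∀ᶠ Q in 𝓝 P, Q ∈ V :=
  h.isOpen.mem_nhds h.mem

theorem eventually_mem_critSet (h : IsCritMarking P V c) (i : Fin (d - 1)) :
    ∀ᶠ Q in 𝓝 P, c i Q ∈ critSet Q :=
  h.eventually_mem.mono fun _ hQ => h.mem_critSet hQ i

theorem differentiableAt (h : IsCritMarking P V c) {Q : Fin (d + 1) → ℂ} (hQ : Q ∈ V)
    (i : Fin (d - 1)) : DifferentiableAt ℂ (c i) Q :=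
  (h.holo i).differentiableAt (h.isOpen.mem_nhds hQ)

theorem contDiffAt (h : IsCritMarking P V c) (hsimple : HasSimpleCritPts P)
    (i : Fin (d - 1)) : ContDiffAt ℂ ω (c i) P := by
  have hmem := h.mem_critSet h.mem i
  obtain ⟨ψ, hψ, -, -, hunique⟩ := exists_critPt_continuation hmem (hsimple _ hmem)
  refine hψ.congr_of_eventuallyEq ?_
  have hgraph : Tendsto (fun Q => (Q, c i Q)) (𝓝 P) (𝓝 (P, c i P)) :=
    continuousAt_id.prodMk (h.differentiableAt h.mem i).continuousAt
  filter_upwards [hgraph.eventually hunique, h.eventually_mem_critSet i] with Q hQ hQc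
  exact (hQ hQc).symm

theorem isSimplePeriodicCritPt (h : IsCritMarking P V c) (hsimple : HasSimpleCritPts P)
    {i : Fin (d - 1)} {m : ℕ} (hm : 1 ≤ m) (hper : (dyn P)^[m] (c i P) = c i P) :
    IsSimplePeriodicCritPt (toPoly P) (c i P) m :=
  ⟨h.mem_critSet h.mem i, hsimple _ (h.mem_critSet h.mem i), hm, hper⟩

variable {m : Fin (d - 1) → ℕ}

theorem fderiv_returnDefect_apply (h : IsCritMarking P V c) (hsimple : HasSimpleCritPts P)
    {i : Fin (d - 1)} {n : ℕ} (hn : 1 ≤ n) (hper : (dyn P)^[n] (c i P) = c i P)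
    (v : Fin (d + 1) → ℂ) :
    fderiv ℂ (returnDefect (toPolyₗ d) (c i) n) P v =
      critVariation (toPoly P) (c i P) n fun z => (toPoly v).eval z :=
  PolyTrans.fderiv_returnDefect_apply (T := toPolyₗ d) (h.isSimplePeriodicCritPt hsimple hn hper)
    (h.differentiableAt h.mem i) (h.eventually_mem_critSet i) v

theorem differentiableAt_returnDefect (h : IsCritMarking P V c) {Q : Fin (d + 1) → ℂ}
    (hQ : Q ∈ V) (i : Fin (d - 1)) (n : ℕ) :
    DifferentiableAt ℂ (returnDefect (toPolyₗ d) (c i) n) Q :=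
  (differentiableAt_iterate_eval (h.differentiableAt hQ i) n).sub (h.differentiableAt hQ i)

theorem mem_perHypersurface_iff {Q : Fin (d + 1) → ℂ} (hQ : Q ∈ V) (i : Fin (d - 1)) :
    Q ∈ perHypersurface V c m i ↔ returnDefect (toPolyₗ d) (c i) (m i) Q = 0 :=
  (and_iff_right hQ).trans sub_eq_zero.symm

theorem linearIndependent_fderiv_returnDefect (h : IsCritMarking P V c) (hd : 2 ≤ d)
    (hsimple : HasSimpleCritPts P) (hm : ∀ i, 1 ≤ m i)
    (hper : ∀ i, (dyn P)^[m i] (c i P) = c i P) :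
    LinearIndependent ℂ fun i => fderiv ℂ (returnDefect (toPolyₗ d) (c i) (m i)) P := by
  have hP := h.subset h.mem
  have hdeg := natDegree_toPoly hP
  refine Fintype.linearIndependent_iff.2 fun l hl => congrFun <|
    eq_zero_of_sum_critVariation_eq_zero (p := toPoly P) (c := fun i => c i P) (m := m)
      (by rwa [hdeg]) (injective_of_range_eq_critSet hd hP hsimple (h.range_eq P h.mem))
      (fun i => h.isSimplePeriodicCritPt hsimple (hm i) (hper i)) fun g hg => ?_
  have hv := congrArg (fun L => L (coeffVec d g)) hl
  simpa only [sum_apply, smul_apply, smul_eq_mul, zero_apply,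
    h.fderiv_returnDefect_apply hsimple (hm _) (hper _),
    toPoly_coeffVec (show g.natDegree ≤ d by omega)] using hv

theorem ker_fderiv_critMap_sub_iterMap (h : IsCritMarking P V c) :
    (fderiv ℂ (critMap c) P - fderiv ℂ (iterMap c m) P).ker =
      ⨅ i, (fderiv ℂ (returnDefect (toPolyₗ d) (c i) (m i)) P).ker := by
  have hc : ∀ i, DifferentiableAt ℂ (c i) P := h.differentiableAt h.mem
  have hiter : ∀ i, DifferentiableAt ℂ (fun Q => (dyn Q)^[m i] (c i Q)) P := fun i =>
    differentiableAt_iterate_eval (T := toPolyₗ d) (hc i) (m i)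
  ext v
  have hcomponent : ∀ i, fderiv ℂ (returnDefect (toPolyₗ d) (c i) (m i)) P v =
      -((fderiv ℂ (critMap c) P - fderiv ℂ (iterMap c m) P) v i) := fun i => by
    have hsub : fderiv ℂ (returnDefect (toPolyₗ d) (c i) (m i)) P = _ :=
      fderiv_fun_sub (hiter i) (hc i)
    have hcrit : fderiv ℂ (critMap c) P = _ := fderiv_pi hc
    have hiterMap : fderiv ℂ (iterMap c m) P = _ := fderiv_pi hiter
    rw [hsub, hcrit, hiterMap]
    exact (neg_sub _ _).symm
  simp only [Submodule.mem_iInf, LinearMap.mem_ker, ContinuousLinearMap.coe_coe, hcomponent,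
    neg_eq_zero, funext_iff, Pi.zero_apply]

theorem isSmoothHypersurfaceAt (h : IsCritMarking P V c) {i : Fin (d - 1)}
    (hper : (dyn P)^[m i] (c i P) = c i P)
    (hne : fderiv ℂ (returnDefect (toPolyₗ d) (c i) (m i)) P ≠ 0) :
    IsSmoothHypersurfaceAt (perHypersurface V c m i) P := by
  refine ⟨⟨h.mem, hper⟩, V, returnDefect (toPolyₗ d) (c i) (m i), h.isOpen, h.mem,
    fun Q hQ => (h.differentiableAt_returnDefect hQ i _).differentiableWithinAt, hne, ?_⟩
  ext Q
  rw [Set.mem_inter_iff, and_comm]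
  exact and_congr_right fun hQ => mem_perHypersurface_iff hQ i

theorem isTransverseAt (h : IsCritMarking P V c) (hsimple : HasSimpleCritPts P)
    (hper : ∀ i, (dyn P)^[m i] (c i P) = c i P)
    (hlin : LinearIndependent ℂ fun i => fderiv ℂ (returnDefect (toPolyₗ d) (c i) (m i)) P) :
    IsTransverseAt (perHypersurface V c m) P := by
  refine ⟨fun i => (fderiv ℂ (returnDefect (toPolyₗ d) (c i) (m i)) P).ker, fun i => ?_, ?_⟩
  · exact (tangentVectors_eq_ker_fderiv (contDiffAt_returnDefect (h.contDiffAt hsimple i) _)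
      ((mem_perHypersurface_iff h.mem i).1 ⟨h.mem, hper i⟩) (hlin.ne_zero i)
      (h.eventually_mem.mono fun Q hQ => mem_perHypersurface_iff hQ i)).symm
  · exact finrank_iInf_ker_clm_add_card hlin

end IsCritMarking

end Marking

/-! ### The affine conjugacy orbit -/

section Curves

variable {d : ℕ}

theorem injective_toPoly_eval_natCast :
    Function.Injective fun (b : Fin (d + 1) → ℂ) (j : Fin (d + 1)) =>
      (toPoly b).eval ((j : ℕ) : ℂ) := fun b b' h => by
  have hdeg : ∀ b : Fin (d + 1) → ℂ,
      (toPoly b).degree < (Finset.univ : Finset (Fin (d + 1))).card := fun b => by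
    rw [Finset.card_fin]
    exact degree_le_natDegree.trans_lt (by exact_mod_cast Nat.lt_succ_of_le (natDegree_toPoly_le b))
  refine toPoly_injective (eq_of_degrees_lt_of_eval_index_eq Finset.univ
    (v := fun j : Fin (d + 1) => ((j : ℕ) : ℂ)) ?_ (hdeg b) (hdeg b') fun j _ => congrFun h j)
  exact (Nat.cast_injective.comp Fin.val_injective).injOn

theorem differentiableAt_of_differentiableAt_eval {γ : ℂ → Fin (d + 1) → ℂ} {t : ℂ}
    (h : ∀ z, DifferentiableAt ℂ (fun s => (toPoly (γ s)).eval z) t) : DifferentiableAt ℂ γ t := by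
  let L : (Fin (d + 1) → ℂ) →ₗ[ℂ] Fin (d + 1) → ℂ :=
    LinearMap.pi fun j => leval ((j : ℕ) : ℂ) ∘ₗ toPolyₗ d
  let e := (LinearEquiv.ofInjectiveEndo L injective_toPoly_eval_natCast).toContinuousLinearEquiv
  exact e.comp_differentiableAt_iff.1 (differentiableAt_pi.2 fun j => h j)

theorem toPoly_deriv_eval {γ : ℂ → Fin (d + 1) → ℂ} {t : ℂ} (hγ : DifferentiableAt ℂ γ t) (z : ℂ) :
    (toPoly (deriv γ t)).eval z = deriv (fun s => (toPoly (γ s)).eval z) t :=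
  ((evalCLM (toPolyₗ d) z).hasFDerivAt.comp_hasDerivAt t hγ.hasDerivAt).deriv.symm

end Curves

section AffineOrbit

variable {d : ℕ} {P Q : Fin (d + 1) → ℂ}

/-- The coefficient vector of `φ⁻¹ ∘ P ∘ φ`, where `φ z = α z + β`. -/
noncomputable def affineConj (P : Fin (d + 1) → ℂ) (α β : ℂ) : Fin (d + 1) → ℂ :=
  coeffVec d (C α⁻¹ * ((toPoly P).comp (C α * X + C β) - C β))

theorem toPoly_affineConj (P : Fin (d + 1) → ℂ) (α β : ℂ) :
    toPoly (affineConj P α β) = C α⁻¹ * ((toPoly P).comp (C α * X + C β) - C β) := by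
  refine toPoly_coeffVec ((natDegree_C_mul_le _ _).trans ?_)
  rw [natDegree_sub_C]
  exact natDegree_comp_le.trans
    ((Nat.mul_le_mul (natDegree_toPoly_le P) natDegree_linear_le).trans (mul_one d).le)

theorem eval_toPoly_affineConj (P : Fin (d + 1) → ℂ) (α β z : ℂ) :
    (toPoly (affineConj P α β)).eval z = α⁻¹ * ((toPoly P).eval (α * z + β) - β) := by
  simp [toPoly_affineConj]

theorem affineConj_one_zero (P : Fin (d + 1) → ℂ) : affineConj P 1 0 = P :=
  toPoly_injective (Polynomial.funext fun z => by simp [eval_toPoly_affineConj])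

theorem affineConj_mem_polyD (hd : d ≠ 0) (hP : P ∈ PolyD d) {α : ℂ} (hα : α ≠ 0) (β : ℂ) :
    affineConj P α β ∈ PolyD d := by
  have hdeg : (toPoly (affineConj P α β)).natDegree = d := by
    rw [toPoly_affineConj, natDegree_C_mul (inv_ne_zero hα), natDegree_sub_C, natDegree_comp,
      natDegree_linear hα, mul_one, natDegree_toPoly hP]
  have hne : toPoly (affineConj P α β) ≠ 0 :=
    ne_zero_of_natDegree_gt (hdeg.symm ▸ Nat.pos_of_ne_zero hd)
  rw [← leadingCoeff_ne_zero, leadingCoeff, hdeg] at hne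
  exact (coeff_toPoly _ (Fin.last d)).symm.trans_ne hne

theorem affineConj_mem_affineOrbit (hd : d ≠ 0) (hP : P ∈ PolyD d) {α : ℂ} (hα : α ≠ 0) (β : ℂ) :
    affineConj P α β ∈ affineOrbit P := by
  refine ⟨affineConj_mem_polyD hd hP hα β, α, β, hα, fun z => ?_⟩
  rw [dyn, eval_toPoly_affineConj, mul_inv_cancel_left₀ hα, sub_add_cancel, dyn]

variable (P) in
/-- The velocity `p' ξ - ξ ∘ p` of the conjugates of the polynomial `p` along the infinitesimal
affine map `ξ z = a z + b`, as a linear function of `(a, b)`. -/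
noncomputable def conjVelocity : ℂ × ℂ →ₗ[ℂ] (Fin (d + 1) → ℂ) where
  toFun ξ := coeffVec d
    (derivative (toPoly P) * (C ξ.1 * X + C ξ.2) - (C ξ.1 * toPoly P + C ξ.2))
  map_add' ξ ξ' := by
    rw [← map_add]
    congr 1
    simp only [Prod.fst_add, Prod.snd_add, C_add]
    ring
  map_smul' s ξ := by
    rw [← map_smul]
    congr 1
    simp only [Prod.smul_fst, Prod.smul_snd, smul_eq_mul, C_mul, smul_eq_C_mul, RingHom.id_apply]
    ring

theorem natDegree_derivative_mul_linear_le {R : Type*} [CommSemiring R] {p : R[X]}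
    (hp : p.natDegree ≤ d) (a b : R) : (derivative p * (C a * X + C b)).natDegree ≤ d := by
  rcases Nat.eq_zero_or_pos p.natDegree with h0 | hpos
  · rw [derivative_of_natDegree_zero h0, zero_mul, natDegree_zero]
    exact d.zero_le
  · exact natDegree_mul_le.trans ((Nat.add_le_add (natDegree_derivative_le p)
      natDegree_linear_le).trans ((Nat.sub_add_cancel hpos).le.trans hp))

theorem toPoly_conjVelocity (P : Fin (d + 1) → ℂ) (ξ : ℂ × ℂ) : toPoly (conjVelocity P ξ) =
    derivative (toPoly P) * (C ξ.1 * X + C ξ.2) - (C ξ.1 * toPoly P + C ξ.2) := by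
  have hP := natDegree_toPoly_le P
  have hconst : (C ξ.1 * toPoly P + C ξ.2).natDegree ≤ d := by
    rw [natDegree_add_C]
    exact (natDegree_C_mul_le _ _).trans hP
  have hdeg := natDegree_sub_le_of_le (natDegree_derivative_mul_linear_le hP ξ.1 ξ.2) hconst
  rw [max_self] at hdeg
  rw [conjVelocity, LinearMap.coe_mk, AddHom.coe_mk]
  exact toPoly_coeffVec hdeg

theorem eval_toPoly_conjVelocity (P : Fin (d + 1) → ℂ) (ξ : ℂ × ℂ) (z : ℂ) :
    (toPoly (conjVelocity P ξ)).eval z = (derivative (toPoly P)).eval z * (ξ.1 * z + ξ.2) -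
      (ξ.1 * (toPoly P).eval z + ξ.2) := by
  simp [toPoly_conjVelocity]

theorem hasDerivAt_eval_affineConj (P : Fin (d + 1) → ℂ) (a b z : ℂ) :
    HasDerivAt (fun t => (toPoly (affineConj P (1 + a * t) (b * t))).eval z)
      ((toPoly (conjVelocity P (a, b))).eval z) 0 := by
  have hα : HasDerivAt (fun t : ℂ => 1 + a * t) a 0 := by
    simpa using ((hasDerivAt_id (0 : ℂ)).const_mul a).const_add 1
  have hβ : HasDerivAt (fun t : ℂ => b * t) b 0 := by
    simpa using (hasDerivAt_id (0 : ℂ)).const_mul b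
  have hP := ((toPoly P).hasDerivAt ((1 + a * 0) * z + b * 0)).comp (0 : ℂ)
    ((hα.mul_const z).add hβ)
  simp only [eval_toPoly_affineConj]
  refine ((hα.fun_inv (by simp)).fun_mul (hP.fun_sub hβ)).congr_deriv ?_
  simp [eval_toPoly_conjVelocity]
  ring

theorem conjVelocity_mem_tangentVectors (hd : d ≠ 0) (hP : P ∈ PolyD d) (ξ : ℂ × ℂ) :
    conjVelocity P ξ ∈ tangentVectors (affineOrbit P) P := by
  obtain ⟨a, b⟩ := ξ
  set γ : ℂ → Fin (d + 1) → ℂ := fun t => affineConj P (1 + a * t) (b * t)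
  have hne : ∀ᶠ t : ℂ in 𝓝 0, 1 + a * t ≠ 0 :=
    ContinuousAt.eventually_ne (by fun_prop) (by simp)
  have hγ : ∀ᶠ t in 𝓝 0, DifferentiableAt ℂ γ t := by
    filter_upwards [hne] with t ht
    refine differentiableAt_of_differentiableAt_eval fun z => ?_
    simp only [γ, eval_toPoly_affineConj]
    fun_prop (disch := exact ht)
  refine mem_tangentVectors_of_eventually hγ (hne.mono fun t ht =>
    affineConj_mem_affineOrbit hd hP ht _) (by simp [γ, affineConj_one_zero]) ?_
  refine toPoly_injective (Polynomial.funext fun z => ?_)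
  rw [toPoly_deriv_eval hγ.self_of_nhds]
  exact (hasDerivAt_eval_affineConj P a b z).deriv

theorem eq_zero_of_derivative_mul_linear_eq {K : Type*} [Field K] [CharZero K] {p : K[X]}
    (hp : 2 ≤ p.natDegree) {a b : K}
    (h : derivative p * (C a * X + C b) = C a * p + C b) : a = 0 ∧ b = 0 := by
  obtain ⟨n, hn⟩ := Nat.exists_eq_add_of_le' hp
  have hlead : p.coeff (n + 2) ≠ 0 := by
    rw [← hn, coeff_natDegree, leadingCoeff_ne_zero]
    exact ne_zero_of_natDegree_gt hp
  have hcoeff : ∀ k, p.coeff (k + 1) * (k + 1) * a + p.coeff (k + 2) * (k + 2) * b =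
      a * p.coeff (k + 1) := fun k => by
    have hk := congrArg (fun q => q.coeff (k + 1)) h
    simp only [mul_add, ← mul_assoc, coeff_add, coeff_mul_X, coeff_mul_C, coeff_C_mul, coeff_C_succ,
      mul_right_comm _ (C a), coeff_derivative, add_zero] at hk
    push_cast at hk
    linear_combination hk
  have ha : a = 0 := by
    have htop := hcoeff (n + 1)
    rw [coeff_eq_zero_of_natDegree_lt (hn.trans_lt (Nat.lt_succ_self _))] at htop
    have : a * (p.coeff (n + 2) * (n + 1)) = 0 := by
      push_cast at htop
      linear_combination htop
    exact (mul_eq_zero.1 this).resolve_right (mul_ne_zero hlead n.cast_add_one_ne_zero)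
  refine ⟨ha, ?_⟩
  have hnext := hcoeff n
  rw [ha, mul_zero, zero_mul, zero_add] at hnext
  exact (mul_eq_zero.1 hnext).resolve_left
    (mul_ne_zero hlead (by exact_mod_cast (n + 1).succ_ne_zero))

theorem finrank_range_conjVelocity (hd : 2 ≤ d) (hP : P ∈ PolyD d) :
    Module.finrank ℂ (LinearMap.range (conjVelocity P)) = 2 := by
  have hinj : Function.Injective (conjVelocity P) := by
    refine (injective_iff_map_eq_zero _).2 fun ξ hξ => ?_
    have hpoly := toPoly_conjVelocity P ξ
    rw [hξ, ← toPolyₗ_apply, map_zero] at hpoly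
    have hzero := eq_zero_of_derivative_mul_linear_eq ((natDegree_toPoly hP).symm ▸ hd)
      (sub_eq_zero.1 hpoly.symm)
    exact Prod.ext hzero.1 hzero.2
  rw [LinearMap.finrank_range_of_inj hinj, Module.finrank_prod, Module.finrank_self]

theorem apply_mem_critSet_of_conj {α β : ℂ} (hα : α ≠ 0)
    (hconj : ∀ z, α * dyn Q z + β = dyn P (α * z + β)) {z : ℂ} (hz : z ∈ critSet Q) :
    α * z + β ∈ critSet P := by
  have hpoly : C α * toPoly Q + C β = (toPoly P).comp (C α * X + C β) :=
    Polynomial.funext fun z => by simpa [dyn] using hconj z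
  have hderiv := congrArg (fun q => (derivative q).eval z) hpoly
  have hz0 : (derivative (toPoly Q)).eval z = 0 := hz
  simpa [critSet, derivative_comp, hz0, hα, eq_comm] using hderiv

theorem isPeriodicPt_of_mem_affineOrbit {N : ℕ}
    (hN : ∀ z ∈ critSet P, Function.IsPeriodicPt (dyn P) N z) (hQ : Q ∈ affineOrbit P) {z : ℂ}
    (hz : z ∈ critSet Q) : Function.IsPeriodicPt (dyn Q) N z := by
  obtain ⟨-, α, β, hα, hconj⟩ := hQ
  have hsemiconj : Function.Semiconj (fun z => α * z + β) (dyn Q) (dyn P) := hconj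
  have hiter := (hsemiconj.iterate_right N z).trans (hN _ (apply_mem_critSet_of_conj hα hconj hz))
  exact mul_left_cancel₀ hα (add_right_cancel hiter)

theorem exists_common_period {X : Type*} {f : X → X} {s : Set X} (hs : s.Finite)
    (hper : ∀ x ∈ s, x ∈ Function.periodicPts f) :
    ∃ N, 1 ≤ N ∧ ∀ x ∈ s, Function.IsPeriodicPt f N x := by
  refine ⟨∏ x ∈ hs.toFinset, Function.minimalPeriod f x, ?_, fun x hx => ?_⟩
  · exact Finset.prod_pos fun x hx =>
      Function.minimalPeriod_pos_of_mem_periodicPts (hper x (hs.mem_toFinset.1 hx))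
  · exact (Function.isPeriodicPt_minimalPeriod f x).trans_dvd
      (Finset.dvd_prod_of_mem _ (hs.mem_toFinset.2 hx))

theorem IsCritMarking.iInf_ker_fderiv_returnDefect {V : Set (Fin (d + 1) → ℂ)}
    {c : Fin (d - 1) → (Fin (d + 1) → ℂ) → ℂ} {m : Fin (d - 1) → ℕ} (h : IsCritMarking P V c)
    (hd : 2 ≤ d) (hsimple : HasSimpleCritPts P) (hm : ∀ i, 1 ≤ m i)
    (hper : ∀ i, (dyn P)^[m i] (c i P) = c i P) :
    ⨅ i, (fderiv ℂ (returnDefect (toPolyₗ d) (c i) (m i)) P).ker =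
      LinearMap.range (conjVelocity P) := by
  refine (Submodule.eq_of_le_of_finrank_eq ?_ ?_).symm
  · rintro _ ⟨ξ, rfl⟩
    refine Submodule.mem_iInf _ |>.2 fun i => ?_
    have hξ : Differentiable ℂ fun z : ℂ => ξ.1 * z + ξ.2 := by fun_prop
    rw [LinearMap.mem_ker]
    refine (h.fderiv_returnDefect_apply hsimple (hm i) (hper i) _).trans ?_
    simp only [eval_toPoly_conjVelocity]
    exact (h.isSimplePeriodicCritPt hsimple (hm i) (hper i)).critVariation_coboundary
      (hξ _) (hξ _)
  · have hcodim := finrank_iInf_ker_clm_add_card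
      (h.linearIndependent_fderiv_returnDefect hd hsimple hm hper)
    rw [Fintype.card_fin, Module.finrank_fin_fun] at hcodim
    rw [finrank_range_conjVelocity hd (h.subset h.mem)]
    omega

theorem tangentVectors_affineOrbit (hd : 2 ≤ d) (hP : P ∈ PolyD d) (hsimple : HasSimpleCritPts P)
    (hper : HasPeriodicCritPts P) :
    tangentVectors (affineOrbit P) P = LinearMap.range (conjVelocity P) := by
  refine Set.Subset.antisymm (fun v hv => ?_) ?_
  · obtain ⟨V, c, h⟩ := exists_isCritMarking hd hP hsimple
    obtain ⟨N, hN, hperiod⟩ := exists_common_period (finite_critSet hd hP) hper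
    rw [← h.iInf_ker_fderiv_returnDefect (m := fun _ => N) hd hsimple (fun _ => hN)
      fun i => hperiod _ (h.mem_critSet h.mem i), SetLike.mem_coe, Submodule.mem_iInf]
    refine fun i => fderiv_apply_eq_zero_of_mem_tangentVectors
      (h.differentiableAt_returnDefect h.mem i N) ?_ hv
    filter_upwards [h.eventually_mem_critSet i] with Q hQ hQP
    exact sub_eq_zero.2 (isPeriodicPt_of_mem_affineOrbit hperiod hQP hQ)
  · rintro _ ⟨ξ, rfl⟩
    exact conjVelocity_mem_tangentVectors (by omega) hP ξ

end AffineOrbit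

end PolyTrans

theorem mainTheorem7 (d : ℕ) (hd : 2 ≤ d) (P : Fin (d + 1) → ℂ) (hP : P ∈ PolyTrans.PolyD d)
    (hhyp : PolyTrans.IsHyperbolic P) (hpcf : PolyTrans.IsPostcriticallyFinite P)
    (hsimple : PolyTrans.HasSimpleCritPts P) (hper : PolyTrans.HasPeriodicCritPts P) :
    (∃ (V : Set (Fin (d + 1) → ℂ)) (c : Fin (d - 1) → (Fin (d + 1) → ℂ) → ℂ),
      PolyTrans.IsCritMarking P V c) ∧
    ∀ (V : Set (Fin (d + 1) → ℂ)) (c : Fin (d - 1) → (Fin (d + 1) → ℂ) → ℂ),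
      PolyTrans.IsCritMarking P V c →
      ∀ m : Fin (d - 1) → ℕ, (∀ i, 1 ≤ m i) →
        (∀ i, (PolyTrans.dyn P)^[m i] (c i P) = c i P) →
        (((fderiv ℂ (PolyTrans.critMap c) P - fderiv ℂ (PolyTrans.iterMap c m) P).ker :
            Submodule ℂ (Fin (d + 1) → ℂ)) : Set (Fin (d + 1) → ℂ)) =
          PolyTrans.tangentVectors (PolyTrans.affineOrbit P) P ∧
        (∀ i, PolyTrans.IsSmoothHypersurfaceAt (PolyTrans.perHypersurface V c m i) P) ∧
        PolyTrans.IsTransverseAt (PolyTrans.perHypersurface V c m) P ∧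
        LinearIndependent ℂ (fun i : Fin (d - 1) =>
          fderiv ℂ (fun Q : Fin (d + 1) → ℂ => (PolyTrans.dyn Q)^[m i] (c i Q) - c i Q) P) := by
  refine ⟨PolyTrans.exists_isCritMarking hd hP hsimple, fun V c h m hm hperm => ?_⟩
  have hlin := h.linearIndependent_fderiv_returnDefect hd hsimple hm hperm
  refine ⟨?_, fun i => h.isSmoothHypersurfaceAt (hperm i) (hlin.ne_zero i),
    h.isTransverseAt hsimple hperm hlin, hlin⟩
  rw [h.ker_fderiv_critMap_sub_iterMap, h.iInf_ker_fderiv_returnDefect hd hsimple hm hperm,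
    PolyTrans.tangentVectors_affineOrbit hd hP hsimple hper]
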